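/- Let $p$ be a prime, $n\ge 1$ an integer, $R$ a commutative $\mathbb F_p$-algebra and $\lambda\in R$. Let $A=A_R^{(\lambda)}=R[T]/(T^{p^n})$ be the $R$-Hopf algebra with comultiplication $T\mapsto T\otimes 1+1\otimes T+\lambda\,T\otimes T$, counit $T\mapsto 0$ and antipode $T\mapsto -T/(1+\lambda T)$. With respect to the basis $e_i=T^i$ ($0\le i<p^n$) write $\Delta_A(e_j)=\sum_i e_i\otimes R_{ij}(e_0,\dots,e_{p^n-1})$ with $R_{ij}$ linear forms, and let $$S=S(A)_\Theta=R\Big[X_1,X_T,\dots,X_{T^{p^n-1}},\tfrac1{\varDelta}\Big],\qquad \varDelta=\det\big(R_{ij}(X_1,X_T,\dots,X_{T^{p^n-1}})\big),$$ with comultiplication $X_{T^j}\mapsto\sum_i X_{T^i}\otimes R_{ij}(X_1,X_T,\dots)$ (where $X_{T^0}=X_1$); this is the coordinate ring of the unit group scheme $U(\Gamma^{(\lambda)})$ of the group algebra of $\Gamma^{(\lambda)}=\operatorname{Spec}A$. The algebra map $j^\#:S\to A$, $X_{T^s}\mapsto T^s$, makes $S$ a right $A$-comodule algebra with coaction $\rho=(\mathrm{id}\otimes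 j^\#)\circ\Delta_S$; let $S^{\mathrm{co}A}=\{x\in S:\rho(x)=x\otimes 1\}$. For an indeterminate $\Lambda$ consider the analogous ring $S_\Lambda$ for the $\mathbb F_p$-algebra $R[\Lambda]$ and the element $\Lambda$. For $2\le s\le p^n-1$ there are elements $P_{(\Lambda)}(X_T^s)\in S_\Lambda$ determined recursively by $$P_{(\Lambda)}(X_T^s)=\frac1{\Lambda^s}\Big\{\frac{(X_1+\Lambda X_T)^sX_1}{\sum_{k=0}^s\binom sk\Lambda^kX_{T^k}}-X_1^s-\sum_{k=2}^{s-1}\binom sk\Lambda^kX_1^{s-k}P_{(\Lambda)}(X_T^k)\Big\},$$ and there is an $R$-algebra map $S_\Lambda\to S$ with $\Lambda\mapsto\lambda$ and $X_{T^s}\mapsto X_{T^s}$. Let $P_{(\lambda)}(X_T^s)\in S$ be the image of $P_{(\Lambda)}(X_T^s)$. Then there is an isomorphism of $R$-algebras $$R\Big[Z_1^{\pm1},Z_T,\dots,Z_{T^{p^n-1}},\ \frac1{Z_1^{p^n}+\lambda^{p^n}Z_T},\ \frac1{Z_1^s+\sum_{k=2}^{s-1}\binom sk\lambda^kZ_1^{s-k}Z_{T^k}+\lambda^sZ_{T^s}}\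 (2\le s\le p^n-1)\Big]\ \xrightarrow{\ \sim\ }\ S^{\mathrm{co}A}$$ given by $Z_1\mapsto X_1$, $Z_T\mapsto X_T^{p^n}$ and $Z_{T^s}\mapsto P_{(\lambda)}(X_T^s)$ for $2\le s\le p^n-1$. Here the left-hand side is the localization of the polynomial ring in $p^n$ variables $Z_1,Z_T,\dots,Z_{T^{p^n-1}}$ over $R$ at the displayed elements. -/

import Mathlib

open scoped TensorProduct

noncomputable section

/-! ## The unit group scheme of the group algebra of a finite free commutative Hopf algebra -/

namespace UnitScheme

variable {R H ι : Type*} [CommRing R] [CommRing H] [HopfAlgebra R H]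
  [Fintype ι] [DecidableEq ι] (b : Module.Basis ι R H)

/-- The elements `R_ij` of `H` determined by `Δ(e_j) = ∑ i, e_i ⊗ R_ij`. -/
def regRep : Matrix ι ι H :=
  Matrix.of fun i j =>
    TensorProduct.lid R H ((b.coord i).rTensor H (Coalgebra.comul (R := R) (b j)))

/-- The linear map `H → R[T_e : e in the basis]` with `e ↦ T_e`. -/
def gen : H →ₗ[R] MvPolynomial ι R :=
  b.constr R (fun i => (MvPolynomial.X i : MvPolynomial ι R))

/-- The matrix `(R_ij(T_{e_1}, …, T_{e_m}))`. -/
def genRegRep : Matrix ι ι (MvPolynomial ι R) :=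
  (regRep b).map (gen b)

/-- The polynomial `det (R_ij(T_{e_1}, …, T_{e_m}))`. -/
def disc : MvPolynomial ι R := (genRegRep b).det

lemma map_disc {B : Type*} [CommRing B] [Algebra R B] (f : MvPolynomial ι R →ₐ[R] B) :
    f (disc b) = (f.mapMatrix (genRegRep b)).det :=
  AlgHom.map_det f (genRegRep b)

/-- The coordinate ring `S(H)_Θ = R[T_{e_1}, …, T_{e_m}, 1 / det (R_ij(T))]` of the unit group
scheme of the group algebra of `Spec H`. -/
abbrev STheta : Type _ := Localization.Away (disc b)

/-- The linear map `H → S(H)_Θ` with `e ↦ T_e` for `e` in the basis. -/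
def genS : H →ₗ[R] STheta b :=
  (IsScalarTower.toAlgHom R (MvPolynomial ι R) (STheta b)).toLinearMap ∘ₗ gen b

lemma gen_basis (i : ι) : gen b (b i) = MvPolynomial.X i := by simp [gen]

lemma sum_tmul_coord {ι : Type*} [Fintype ι] (b : Module.Basis ι R H) (z : H ⊗[R] H) :
    ∑ i, b i ⊗ₜ[R] TensorProduct.lid R H ((b.coord i).rTensor H z) = z := by
  induction z with
  | zero => simp
  | add x y hx hy =>
    simp only [map_add, TensorProduct.tmul_add, Finset.sum_add_distrib, hx, hy]
  | tmul x y =>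
    simp only [LinearMap.rTensor_tmul, TensorProduct.lid_tmul, ← TensorProduct.smul_tmul,
      ← TensorProduct.sum_tmul, Module.Basis.coord_apply, b.sum_repr]

lemma comul_basis {ι : Type*} [Fintype ι] (b : Module.Basis ι R H) (j : ι) :
    Coalgebra.comul (R := R) (b j) = ∑ i, b i ⊗ₜ[R] regRep b i j :=
  (sum_tmul_coord b _).symm

lemma comul_regRep (i j : ι) :
    Coalgebra.comul (R := R) (regRep b i j) = ∑ k, regRep b i k ⊗ₜ[R] regRep b k j := by
  have h := LinearMap.congr_fun (Coalgebra.coassoc (R := R) (A := H)) (b j)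
  simp only [LinearMap.comp_apply, LinearEquiv.coe_coe, comul_basis, map_sum,
    LinearMap.rTensor_tmul, LinearMap.lTensor_tmul, TensorProduct.sum_tmul,
    TensorProduct.assoc_tmul] at h
  have h2 := congrArg (fun z => TensorProduct.lid R (H ⊗[R] H)
    ((b.coord i).rTensor (H ⊗[R] H) z)) h
  simp only [map_sum, LinearMap.rTensor_tmul, TensorProduct.lid_tmul, Module.Basis.coord_apply,
    Module.Basis.repr_self, Finsupp.single_apply, ite_smul, one_smul, zero_smul,
    Finset.sum_ite_eq', Finset.mem_univ, if_true] at h2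
  exact h2.symm

lemma counit_regRep (i j : ι) :
    Coalgebra.counit (R := R) (regRep b i j) = if i = j then 1 else 0 := by
  have h := LinearMap.congr_fun (Coalgebra.lTensor_counit_comp_comul (R := R) (A := H)) (b j)
  simp only [LinearMap.comp_apply, comul_basis, map_sum, LinearMap.lTensor_tmul] at h
  have h2 := congrArg (fun z => b.coord i (TensorProduct.rid R H z)) h
  simpa [Finsupp.single_apply, eq_comm] using h2

lemma isUnit_det_regRep : IsUnit (regRep b).det := by
  have h : regRep b * (regRep b).map (HopfAlgebra.antipode R) = 1 := by
    ext i j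
    have := HopfAlgebra.mul_antipode_lTensor_comul_apply (R := R) (regRep b i j)
    rw [comul_regRep, counit_regRep] at this
    simp only [map_sum, LinearMap.lTensor_tmul, LinearMap.mul'_apply] at this
    rw [Matrix.mul_apply, Matrix.one_apply]
    simp only [Matrix.map_apply, this]
    split_ifs <;> simp
  exact (Matrix.isUnit_iff_isUnit_det _).mp (IsUnit.of_mul_eq_one _ h)

/-- The comultiplication `T_{e_j} ↦ ∑ i, T_{e_i} ⊗ R_ij(T)` on `R[T_e]`, with values in
`S(H)_Θ ⊗ S(H)_Θ`. -/
def comulPoly : MvPolynomial ι R →ₐ[R] STheta b ⊗[R] STheta b :=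
  MvPolynomial.aeval fun j => ∑ i, genS b (b i) ⊗ₜ[R] genS b (regRep b i j)

lemma comulPoly_gen (h : H) :
    comulPoly b (gen b h) =
      TensorProduct.map (genS b) (genS b) (Coalgebra.comul (R := R) h) := by
  have : (comulPoly b).toLinearMap ∘ₗ gen b =
      TensorProduct.map (genS b) (genS b) ∘ₗ Coalgebra.comul (R := R) := by
    refine b.ext fun j => ?_
    simp [gen_basis, comulPoly, comul_basis]
  exact LinearMap.congr_fun this h

lemma isUnit_comulPoly_disc : IsUnit (comulPoly b (disc b)) := by
  let f₀ := IsScalarTower.toAlgHom R (MvPolynomial ι R) (STheta b)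
  let l : MvPolynomial ι R →ₐ[R] STheta b ⊗[R] STheta b :=
    Algebra.TensorProduct.includeLeft.comp f₀
  let r : MvPolynomial ι R →ₐ[R] STheta b ⊗[R] STheta b :=
    Algebra.TensorProduct.includeRight.comp f₀
  have hM : (comulPoly b).mapMatrix (genRegRep b) =
      l.mapMatrix (genRegRep b) * r.mapMatrix (genRegRep b) := by
    ext i j
    rw [Matrix.mul_apply]
    simp only [AlgHom.mapMatrix_apply, Matrix.map_apply, genRegRep, comulPoly_gen, comul_regRep,
      map_sum, TensorProduct.map_tmul]
    refine Finset.sum_congr rfl fun k _ => ?_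
    simp [l, r, f₀, genS]
  have hu : IsUnit (f₀ (disc b)) := IsLocalization.Away.algebraMap_isUnit (disc b)
  have hd : comulPoly b (disc b) = l (disc b) * r (disc b) := by
    rw [map_disc, map_disc, map_disc, hM, Matrix.det_mul]
  rw [hd]
  exact (hu.map (Algebra.TensorProduct.includeLeft (R := R) (S := R) (B := STheta b))).mul
    (hu.map (Algebra.TensorProduct.includeRight (R := R) (A := STheta b)))

/-- Extension of an `R`-algebra map `R[T_e] → B` to `S(H)_Θ`. -/
def liftS {B : Type*} [CommRing B] [Algebra R B] (f : MvPolynomial ι R →ₐ[R] B)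
    (hf : IsUnit (f (disc b))) : STheta b →ₐ[R] B :=
  IsLocalization.liftAlgHom (M := Submonoid.powers (disc b)) (f := f) (by
    rintro ⟨_, m, rfl⟩
    simpa using hf.pow m)

/-- The comultiplication of `S(H)_Θ`. -/
def comulS : STheta b →ₐ[R] STheta b ⊗[R] STheta b :=
  liftS b (comulPoly b) (isUnit_comulPoly_disc b)

lemma isUnit_aeval_disc :
    IsUnit (MvPolynomial.aeval (R := R) (fun i => b i) (disc b)) := by
  have hg : ∀ h, MvPolynomial.aeval (R := R) (fun i => b i) (gen b h) = h := fun h =>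
    LinearMap.congr_fun (b.ext (f₁ := (MvPolynomial.aeval (R := R) fun i => b i).toLinearMap ∘ₗ
      gen b) (f₂ := LinearMap.id) fun i => by simp [gen_basis]) h
  have : (MvPolynomial.aeval (R := R) fun i => b i).mapMatrix (genRegRep b) = regRep b := by
    ext i j
    simp [genRegRep, hg]
  rw [map_disc, this]
  exact isUnit_det_regRep b

/-- The algebra map `S(H)_Θ → H`, `T_e ↦ e`, of the canonical closed immersion of `Spec H` into
the unit group scheme of its group algebra. -/
def toHopf : STheta b →ₐ[R] H :=
  liftS b (MvPolynomial.aeval fun i => b i) (isUnit_aeval_disc b)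

/-- The right `H`-comodule algebra structure of `S(H)_Θ` induced by `toHopf`. -/
def coaction : STheta b →ₐ[R] STheta b ⊗[R] H :=
  (Algebra.TensorProduct.map (AlgHom.id R (STheta b)) (toHopf b)).comp (comulS b)

/-- The coinvariant subalgebra `S(H)_Θ^{co H} = {x | ρ(x) = x ⊗ 1}`. -/
def coinvariants : Subalgebra R (STheta b) :=
  AlgHom.equalizer (coaction b) Algebra.TensorProduct.includeLeft

end UnitScheme

/-! ## The Hopf algebra `A^(λ) = R[T]/(T^{p^n})` -/

section Lambda

open Polynomial

variable {R : Type*} [CommRing R] (p n : ℕ)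

/-- The ring `R[T]/(T^{p^n})`. The parameter `lam` determines the Hopf algebra structure. -/
def ALambda (_lam : R) : Type _ := AdjoinRoot ((X : R[X]) ^ p ^ n)

variable (lam : R)

instance : CommRing (ALambda p n lam) :=
  inferInstanceAs (CommRing (AdjoinRoot ((X : R[X]) ^ p ^ n)))

instance : Algebra R (ALambda p n lam) :=
  inferInstanceAs (Algebra R (AdjoinRoot ((X : R[X]) ^ p ^ n)))

namespace ALambda

/-- The class of `T`. -/
def T : ALambda p n lam := AdjoinRoot.root ((X : R[X]) ^ p ^ n)

lemma T_pow : T p n lam ^ p ^ n = 0 := by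
  have := AdjoinRoot.eval₂_root ((X : R[X]) ^ p ^ n)
  rwa [eval₂_pow, eval₂_X] at this

variable {p n lam} in
/-- The algebra map out of `R[T]/(T^{p^n})` that sends `T` to `x`. -/
def lift {B : Type*} [CommRing B] [Algebra R B] (x : B) (hx : x ^ p ^ n = 0) :
    ALambda p n lam →ₐ[R] B :=
  AdjoinRoot.liftAlgHom ((X : R[X]) ^ p ^ n) (Algebra.ofId R B) x (by
    rw [eval₂_pow, eval₂_X, hx])

variable {p n lam} in
lemma lift_T {B : Type*} [CommRing B] [Algebra R B] (x : B) (hx : x ^ p ^ n = 0) :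
    lift (lam := lam) x hx (T p n lam) = x :=
  AdjoinRoot.liftAlgHom_root _ _ _ _

variable {p n lam} in
lemma hom_ext {B : Type*} [CommRing B] [Algebra R B] {f g : ALambda p n lam →ₐ[R] B}
    (h : f (T p n lam) = g (T p n lam)) : f = g :=
  AdjoinRoot.algHom_ext (f := (X : R[X]) ^ p ^ n) h

/-- The quotient map `R[T] → R[T]/(T^{p^n})`. -/
def mk : R[X] →ₐ[R] ALambda p n lam := AdjoinRoot.mkₐ ((X : R[X]) ^ p ^ n)

/-- The representative of degree less than `p ^ n`. -/
def rep : ALambda p n lam →ₗ[R] R[X] := AdjoinRoot.modByMonicHom (monic_X_pow (R := R) (p ^ n))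

lemma mk_X : mk p n lam X = T p n lam := AdjoinRoot.mk_X

lemma mk_surjective : Function.Surjective (mk p n lam) := AdjoinRoot.mk_surjective

lemma rep_mk (q : R[X]) : rep p n lam (mk p n lam q) = q %ₘ X ^ p ^ n :=
  AdjoinRoot.modByMonicHom_mk _ q

lemma mk_rep (f : ALambda p n lam) : mk p n lam (rep p n lam f) = f :=
  AdjoinRoot.mk_leftInverse (monic_X_pow (R := R) (p ^ n)) f

lemma mk_monomial (i : ℕ) (r : R) : mk p n lam (monomial i r) = r • T p n lam ^ i := by
  rw [← smul_X_eq_monomial, map_smul, map_pow, mk_X]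

/-- The basis `1, T, …, T^{p^n - 1}`. -/
def basis [Fact p.Prime] : Module.Basis (Fin (p ^ n)) R (ALambda p n lam) :=
  .ofEquivFun
    { toFun := fun f i => (rep p n lam f).coeff i
      invFun := fun c => ∑ i, c i • T p n lam ^ (i : ℕ)
      map_add' := fun f g => by ext i; simp
      map_smul' := fun r f => by ext i; simp
      left_inv := fun f => by
        have : Subsingleton R → Subsingleton (ALambda p n lam) := fun _ =>
          Module.subsingleton R _
        rcases subsingleton_or_nontrivial R with h | h
        · exact (this h).elim _ _
        have h0 : p ^ n ≠ 0 := pow_ne_zero _ (Fact.out : p.Prime).ne_zero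
        have hm : ((X : R[X]) ^ p ^ n).Monic := monic_X_pow _
        obtain ⟨q, rfl⟩ := mk_surjective p n lam f
        have hd : (rep p n lam (mk p n lam q)).natDegree < p ^ n := by
          rw [rep_mk]
          simpa using natDegree_modByMonic_lt q hm (by
            intro h1
            exact h0 (by simpa using congrArg natDegree h1))
        conv_rhs => rw [← mk_rep p n lam (mk p n lam q), as_sum_range' _ _ hd, map_sum,
          Finset.sum_range]
        simp only [mk_monomial]
      right_inv := fun c => by
        rcases subsingleton_or_nontrivial R with h | h
        · exact Subsingleton.elim _ _
        have hm : ((X : R[X]) ^ p ^ n).Monic := monic_X_pow _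
        have hd : (∑ i : Fin (p ^ n), monomial (i : ℕ) (c i)).degree < (p ^ n : ℕ) :=
          (degree_sum_le _ _).trans_lt ((Finset.sup_lt_iff (WithBot.bot_lt_coe _)).2 fun i _ =>
            (degree_monomial_le _ _).trans_lt (by exact_mod_cast i.2))
        ext i
        simp only [← mk_monomial]
        rw [← map_sum, rep_mk, (modByMonic_eq_self_iff hm).2 (by simpa using hd)]
        simp [coeff_monomial, Fin.val_inj] }

lemma basis_apply [Fact p.Prime] (i : Fin (p ^ n)) : basis p n lam i = T p n lam ^ (i : ℕ) := by
  simp [basis, Pi.single_apply]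

lemma natCast_eq_zero [Algebra (ZMod p) R] (B : Type*) [CommRing B] [Algebra R B] :
    (p : B) = 0 := by
  have h : ((p : ℕ) : ZMod p) = 0 := ZMod.natCast_self p
  have := congrArg (fun x => algebraMap R B (algebraMap (ZMod p) R x)) h
  simpa only [map_natCast, map_zero] using this

variable [Fact p.Prime] [Algebra (ZMod p) R]

lemma add_pow_p {B : Type*} [CommRing B] [Algebra R B] (x y : B) :
    (x + y) ^ p ^ n = x ^ p ^ n + y ^ p ^ n := by
  obtain ⟨r, hr⟩ := exists_add_pow_prime_pow_eq (Fact.out : p.Prime) x y n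
  rw [hr, natCast_eq_zero (R := R) p B]
  ring

lemma comul_pow :
    (T p n lam ⊗ₜ[R] (1 : ALambda p n lam) + 1 ⊗ₜ[R] T p n lam
      + lam • (T p n lam ⊗ₜ[R] T p n lam)) ^ p ^ n = 0 := by
  have hp : p ^ n ≠ 0 := pow_ne_zero _ (Fact.out : p.Prime).ne_zero
  rw [add_pow_p (R := R), add_pow_p (R := R), _root_.smul_pow]
  simp [Algebra.TensorProduct.tmul_pow, T_pow]

/-- `T ↦ T ⊗ 1 + 1 ⊗ T + λ T ⊗ T`. -/
def comulHom : ALambda p n lam →ₐ[R] ALambda p n lam ⊗[R] ALambda p n lam :=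
  lift (T p n lam ⊗ₜ[R] (1 : ALambda p n lam) + 1 ⊗ₜ[R] T p n lam
      + lam • (T p n lam ⊗ₜ[R] T p n lam)) (comul_pow p n lam)

/-- `T ↦ 0`. -/
def counitHom : ALambda p n lam →ₐ[R] R :=
  lift 0 (zero_pow (pow_ne_zero _ (Fact.out : p.Prime).ne_zero))

lemma one_add_pow : (1 + lam • T p n lam) ^ p ^ n = 1 := by
  rw [add_pow_p (R := R), _root_.smul_pow, T_pow]; simp

lemma one_add_mul : (1 + lam • T p n lam) * (1 + lam • T p n lam) ^ (p ^ n - 1) = 1 := by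
  rw [mul_pow_sub_one (pow_ne_zero _ (Fact.out : p.Prime).ne_zero), one_add_pow]

/-- `T ↦ -T / (1 + λ T)`, where `(1 + λ T)⁻¹ = (1 + λ T) ^ (p ^ n - 1)` because
`(1 + λ T) ^ (p ^ n) = 1`. -/
def antipodeHom : ALambda p n lam →ₐ[R] ALambda p n lam :=
  lift (-(T p n lam * (1 + lam • T p n lam) ^ (p ^ n - 1))) (by
    rw [neg_pow, mul_pow, T_pow]; simp)

instance : Bialgebra R (ALambda p n lam) :=
  Bialgebra.ofAlgHom (comulHom p n lam) (counitHom p n lam)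
    (hom_ext (by
      simp [comulHom, lift_T, Algebra.TensorProduct.one_def, TensorProduct.add_tmul,
        TensorProduct.tmul_add, smul_add, TensorProduct.tmul_smul, ← TensorProduct.smul_tmul']
      abel))
    (hom_ext (by simp [comulHom, counitHom, lift_T]))
    (hom_ext (by simp [comulHom, counitHom, lift_T]))

/-- The Hopf algebra `A^(λ)`. -/
instance : HopfAlgebra R (ALambda p n lam) :=
  HopfAlgebra.ofAlgHom (antipodeHom p n lam)
    (hom_ext (by
      have h := one_add_mul p n lam
      change Algebra.TensorProduct.lift _ _ (fun _ _ => Commute.all _ _) (comulHom p n lam (T p n lam)) =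
        algebraMap R _ (counitHom p n lam (T p n lam))
      simp only [comulHom, counitHom, antipodeHom, lift_T, map_add, map_smul, map_zero,
        Algebra.TensorProduct.lift_tmul, map_one, one_mul, mul_one, AlgHom.id_apply]
      simp only [Algebra.smul_def] at h ⊢
      linear_combination (-T p n lam) * h))
    (hom_ext (by
      have h := one_add_mul p n lam
      change Algebra.TensorProduct.lift _ _ (fun _ _ => Commute.all _ _) (comulHom p n lam (T p n lam)) =
        algebraMap R _ (counitHom p n lam (T p n lam))
      simp only [comulHom, counitHom, antipodeHom, lift_T, map_add, map_smul, map_zero,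
        Algebra.TensorProduct.lift_tmul, map_one, one_mul, mul_one, AlgHom.id_apply]
      simp only [Algebra.smul_def] at h ⊢
      linear_combination (-T p n lam) * h))

end ALambda

/-- The coordinate ring `S(A^(λ))_Θ = R[X_1, X_T, …, X_{T^{p^n-1}}, 1/Δ]`. -/
abbrev SLambda [Fact p.Prime] [Algebra (ZMod p) R] : Type _ :=
  UnitScheme.STheta (ALambda.basis p n lam)

/-- The coinvariant subalgebra of `S(A^(λ))_Θ` under `A^(λ)`. -/
abbrev coinvLambda [Fact p.Prime] [Algebra (ZMod p) R] : Subalgebra R (SLambda p n lam) :=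
  UnitScheme.coinvariants (ALambda.basis p n lam)

/-- The generator `X_{T^s}` of `S(A^(λ))_Θ`, for `s < p ^ n`; here `XT 0` is `X_1`. -/
def XT [Fact p.Prime] [Algebra (ZMod p) R] (s : ℕ) : SLambda p n lam :=
  UnitScheme.genS (ALambda.basis p n lam) (ALambda.T p n lam ^ s)

/-- `∑_{k=0}^{s} binom(s,k) λ^k X_{T^k}`. -/
def ell [Fact p.Prime] [Algebra (ZMod p) R] (s : ℕ) : SLambda p n lam :=
  ∑ k ∈ Finset.range (s + 1), (s.choose k * lam ^ k : R) • XT p n lam k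

variable (R) in
/-- The family `P_(Λ)(X_T^s)`, `2 ≤ s < p ^ n`, in `R[Λ][X_1, X_T, …, 1/Δ_(Λ)]`, where
`Λ = (X : R[X])`:
`P_s = Λ^{-s} ((X_1 + Λ X_T)^s X_1 / ell_s - X_1^s - ∑_{k=2}^{s-1} binom(s,k) Λ^k X_1^{s-k} P_k)`.
Written without fractions; `Λ` is a nonzerodivisor and `ell_s` a unit, so that this determines
`P_s`. -/
def IsGenericP [Fact p.Prime] [Algebra (ZMod p) R] (P : ℕ → SLambda p n (X : R[X])) : Prop :=
  ∀ s, 2 ≤ s → s < p ^ n →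
    ((X : R[X]) ^ s) • P s * ell p n (X : R[X]) s =
      (XT p n (X : R[X]) 0 + (X : R[X]) • XT p n (X : R[X]) 1) ^ s * XT p n (X : R[X]) 0
        - (XT p n (X : R[X]) 0 ^ s
          + ∑ k ∈ Finset.Ico 2 s,
              (s.choose k * (X : R[X]) ^ k : R[X]) • (XT p n (X : R[X]) 0 ^ (s - k) * P k))
          * ell p n (X : R[X]) s

/-- `σ` is the substitution `Λ ↦ λ`, i.e. the ring map
`R[Λ][X_1, X_T, …, 1/Δ_(Λ)] → R[X_1, X_T, …, 1/Δ]` with `Λ ↦ λ` and `X_{T^s} ↦ X_{T^s}` that is the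
identity on `R`. -/
def IsSubstitution [Fact p.Prime] [Algebra (ZMod p) R]
    (σ : SLambda p n (X : R[X]) →+* SLambda p n lam) : Prop :=
  (∀ f : R[X], σ (algebraMap R[X] _ f) = algebraMap R _ (f.eval lam)) ∧
    ∀ s, s < p ^ n → σ (XT p n (X : R[X]) s) = XT p n lam s

variable (R) in
/-- The variable `Z_{T^k}` of `R[Z_1, Z_T, …, Z_{T^{p^n-1}}]`, for `k < p ^ n`; here `zvar 0` is
`Z_1`. -/
def zvar (k : ℕ) : MvPolynomial (Fin (p ^ n)) R :=
  if h : k < p ^ n then MvPolynomial.X ⟨k, h⟩ else 0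

/-- `Z_1^s + ∑_{k=2}^{s-1} binom(s,k) λ^k Z_1^{s-k} Z_{T^k} + λ^s Z_{T^s}`. -/
def zden (s : ℕ) : MvPolynomial (Fin (p ^ n)) R :=
  zvar R p n 0 ^ s
    + ∑ k ∈ Finset.Ico 2 s, (s.choose k * lam ^ k : R) • (zvar R p n 0 ^ (s - k) * zvar R p n k)
    + lam ^ s • zvar R p n s

/-- The localized polynomial ring `R[Z_1^{±1}, Z_T, …, Z_{T^{p^n-1}},
1 / (Z_1^{p^n} + λ^{p^n} Z_T), 1 / zden_s (2 ≤ s ≤ p^n - 1)]`. -/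
abbrev ZRing : Type _ :=
  Localization.Away (zvar R p n 0 * (zvar R p n 0 ^ p ^ n + lam ^ p ^ n • zvar R p n 1)
    * ∏ s ∈ Finset.Ico 2 (p ^ n), zden p n lam s)

/-- The element `Z_{T^k}` of the localized polynomial ring. -/
def ZT (k : ℕ) : ZRing p n lam := algebraMap _ _ (zvar R p n k)

end Lambda

end

/-! A `D`-point of `S` is an invertible element of the convolution ring of linear maps `A → D`; the
identity of `S` corresponds to `genConv`, and the coaction multiplies `genConv` on the right by the
inclusion `A → S ⊗ A`. Put `g = 1 + λT`, which is group-like and satisfies `Δ T = T ⊗ g + 1 ⊗ T`.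

Let `r = X_T / X_1`. Since `ρ(r) = r ⊗ g + 1 ⊗ T`, the convolution element `powMap r : T^s ↦ r^s`
(`s < p^n`) is translated by the same right factor as `genConv`. So `quot = powMap r * genConv⁻¹` is
fixed by the coaction (`rho_quot`). The elements `P_s` are its normalized values `X_1^(s+1) ·
quot(T^s)`; evaluating `quot * genConv = powMap r` at the group-like `g^s` gives their recursion
(`PT_recursion`). Evaluating at `T^s` instead gives a system with unit diagonal and no division by
`λ`, so the `P_s` are compatible with `Λ ↦ λ` (`subst_PT`). As `g^(p^n) = 1` and `T^(p^n) = 0`,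
`X_T^(p^n)` is coinvariant too.

Conversely `X_1`, `X_T` and `quot` recover `genConv = quot⁻¹ * powMap r`. Hence `S` is obtained from
`ZRing` by adjoining a `p^n`-th root `x = X_T` of `Z_T`: the inverted denominators are just what
makes the convolution elements over `Cover` invertible. This gives injectivity of `zHom` and shows
that the powers `X_T^i`, `i < p^n`, span `S` over its image. Comparing coefficients of `T^m` in `ρ(∑
a_i X_T^i)` then leaves only `a_0` for a coinvariant element (`exists_zHom_eq`). -/

noncomputable section

open WithConv

/-! ### Algebra maps out of `S(H)_Θ` and the coaction on generators. -/

namespace UnitScheme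

variable {R H ι : Type*} [CommRing R] [CommRing H] [HopfAlgebra R H]
  [Fintype ι] [DecidableEq ι] (b : Module.Basis ι R H)
  {D : Type*} [CommRing D] [Algebra R D]

lemma aeval_gen (a : H →ₗ[R] D) (h : H) :
    MvPolynomial.aeval (R := R) (fun i => a (b i)) (gen b h) = a h :=
  LinearMap.congr_fun (b.ext (f₁ := (MvPolynomial.aeval (R := R) fun i => a (b i)).toLinearMap ∘ₗ
    gen b) (f₂ := a) fun i => by simp [gen_basis]) h

lemma liftS_algebraMap (f : MvPolynomial ι R →ₐ[R] D) (hf : IsUnit (f (disc b)))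
    (x : MvPolynomial ι R) : liftS b f hf (algebraMap _ _ x) = f x := by
  simp [liftS]

lemma liftS_genS (f : MvPolynomial ι R →ₐ[R] D) (hf : IsUnit (f (disc b))) (h : H) :
    liftS b f hf (genS b h) = f (gen b h) :=
  liftS_algebraMap b f hf _

lemma algHom_ext {f g : STheta b →ₐ[R] D} (h : ∀ i, f (genS b (b i)) = g (genS b (b i))) :
    f = g := by
  apply IsLocalization.algHom_ext (Submonoid.powers (disc b))
  apply MvPolynomial.algHom_ext
  intro i
  have := h i
  simp only [genS, LinearMap.comp_apply, gen_basis] at this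
  exact this

lemma coaction_genS (h : H) :
    coaction b (genS b h) = (genS b).rTensor H (Coalgebra.comul (R := R) h) := by
  have hH : ∀ x, toHopf b (genS b x) = x := fun x => by
    rw [toHopf, liftS_genS]
    exact aeval_gen b LinearMap.id x
  rw [coaction, AlgHom.comp_apply, comulS, liftS_genS, comulPoly_gen]
  generalize Coalgebra.comul (R := R) h = z
  induction z with
  | zero => simp
  | add x y hx hy => simp only [map_add, hx, hy]
  | tmul x y => simp [hH]

end UnitScheme

/-! ### Functoriality of convolution rings in the target algebra. -/

section Convolution

variable {R C D E : Type*} [CommRing R] [AddCommGroup C] [Module R C] [Coalgebra R C]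
  [CommRing D] [Algebra R D] [CommRing E] [Algebra R E]

/-- Composition with an algebra map, as a ring map of convolution rings. -/
def convMap (f : D →ₐ[R] E) : WithConv (C →ₗ[R] D) →+* WithConv (C →ₗ[R] E) where
  toFun a := toConv (f.toLinearMap ∘ₗ a.ofConv)
  map_one' := by ext; simp
  map_mul' a c := WithConv.ext (LinearMap.algHom_comp_convMul_distrib f a c)
  map_zero' := by ext; simp
  map_add' a c := by ext; simp

@[simp]
lemma convMap_apply (f : D →ₐ[R] E) (a : WithConv (C →ₗ[R] D)) (c : C) :
    convMap f a c = f (a c) := rfl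

end Convolution

/-! ### The group-like `g = 1 + λT` and invertibility in the convolution ring of `A`. -/

namespace ALambda

variable {R : Type*} [CommRing R] (p n : ℕ) (lam : R)

/-- The element `1 + λ T`. -/
def g : ALambda p n lam := 1 + lam • T p n lam

variable {p n lam} in
lemma apply_g_pow {M : Type*} [AddCommGroup M] [Module R M] (a : ALambda p n lam →ₗ[R] M)
    (k : ℕ) :
    a (g p n lam ^ k) =
      ∑ i ∈ Finset.range (k + 1), (k.choose i * lam ^ i : R) • a (T p n lam ^ i) := by
  rw [g, add_comm, add_pow, map_sum]
  refine Finset.sum_congr rfl fun i _ => ?_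
  rw [← map_smul]
  congr 1
  simp only [one_pow, mul_one, Algebra.smul_def, mul_pow, map_mul, map_natCast, map_pow]
  ring

variable [Fact p.Prime]

variable {p n} in
lemma basis_mk {k : ℕ} (hk : k < p ^ n) : basis p n lam ⟨k, hk⟩ = T p n lam ^ k :=
  basis_apply p n lam _

variable {p n lam} in
lemma conv_ext {D : Type*} [AddCommGroup D] [Module R D]
    {a b : WithConv (ALambda p n lam →ₗ[R] D)}
    (h : ∀ k, k < p ^ n → a (T p n lam ^ k) = b (T p n lam ^ k)) : a = b :=
  WithConv.ext ((basis p n lam).ext fun i => by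
    rw [basis_apply]
    exact h i i.2)

/-- The linear map `T ^ j ↦ u ^ j` for `j < p ^ n`. -/
def powMap {D : Type*} [CommRing D] [Algebra R D] (u : D) : WithConv (ALambda p n lam →ₗ[R] D) :=
  toConv ((basis p n lam).constr R fun i => u ^ (i : ℕ))

variable {p n lam} in
lemma powMap_T_pow {D : Type*} [CommRing D] [Algebra R D] (u : D) {k : ℕ} (hk : k < p ^ n) :
    powMap p n lam u (T p n lam ^ k) = u ^ k := by
  rw [← basis_mk lam hk]
  simp [powMap]

variable {p n lam} in
-- `powMap u` is only linear, and `u ^ p ^ n` need not vanish; for `k < p ^ n` the binomial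
-- expansion of `g ^ k` stays among the basis powers of `T`, where it agrees with evaluation at `u`.
lemma powMap_g_pow {D : Type*} [CommRing D] [Algebra R D] (u : D) {k : ℕ} (hk : k < p ^ n) :
    powMap p n lam u (g p n lam ^ k) = (1 + lam • u) ^ k := by
  rw [apply_g_pow, add_comm 1, add_pow]
  refine Finset.sum_congr rfl fun i hi => ?_
  rw [powMap_T_pow u ((Nat.lt_succ_iff.1 (Finset.mem_range.1 hi)).trans_lt hk)]
  simp only [one_pow, mul_one, Algebra.smul_def, mul_pow, map_mul, map_natCast, map_pow]
  ring

variable [Algebra (ZMod p) R]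

lemma comul_T : Coalgebra.comul (R := R) (T p n lam) =
    T p n lam ⊗ₜ[R] g p n lam + 1 ⊗ₜ[R] T p n lam := by
  change comulHom p n lam (T p n lam) = _
  rw [comulHom, lift_T, g, TensorProduct.tmul_add, TensorProduct.tmul_smul]
  abel

lemma counit_T : Coalgebra.counit (R := R) (T p n lam) = 0 :=
  lift_T (lam := lam) 0 (zero_pow (pow_ne_zero n (Fact.out : p.Prime).ne_zero))

lemma comul_g : Coalgebra.comul (R := R) (g p n lam) = g p n lam ⊗ₜ[R] g p n lam := by
  conv_lhs => rw [g, map_add, map_smul, comul_T, Bialgebra.comul_one]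
  rw [smul_add, TensorProduct.smul_tmul', ← TensorProduct.tmul_smul,
    Algebra.TensorProduct.one_def, add_left_comm, ← TensorProduct.tmul_add, ← g,
    ← TensorProduct.add_tmul, add_comm, ← g]

lemma comul_g_pow (k : ℕ) : Coalgebra.comul (R := R) (g p n lam ^ k) =
    (g p n lam ^ k) ⊗ₜ[R] (g p n lam ^ k) := by
  rw [Bialgebra.comul_pow, comul_g, Algebra.TensorProduct.tmul_pow]

lemma counit_g_pow (k : ℕ) : Coalgebra.counit (R := R) (g p n lam ^ k) = 1 := by
  rw [Bialgebra.counit_pow, g, map_add, map_smul, counit_T, Bialgebra.counit_one]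
  simp

lemma comul_T_pow (j : ℕ) : Coalgebra.comul (R := R) (T p n lam ^ j) =
    ∑ i ∈ Finset.range (j + 1),
      (j.choose i : R) • ((T p n lam ^ i) ⊗ₜ[R] (g p n lam ^ i * T p n lam ^ (j - i))) := by
  rw [Bialgebra.comul_pow, comul_T, add_pow]
  refine Finset.sum_congr rfl fun i _ => ?_
  simp only [Algebra.TensorProduct.tmul_pow, Algebra.TensorProduct.tmul_mul_tmul, one_pow, mul_one,
    Algebra.smul_def, map_natCast]
  ring

/-- Makes the convolution rings commutative, so that one-sided inverses suffice. -/
instance : Coalgebra.IsCocomm R (ALambda p n lam) where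
  comm_comp_comul := by
    have h : ((Algebra.TensorProduct.comm R (ALambda p n lam) (ALambda p n lam)).toAlgHom.comp
        (Bialgebra.comulAlgHom R (ALambda p n lam))) = Bialgebra.comulAlgHom R _ := by
      refine hom_ext ?_
      simp [comul_T, g, TensorProduct.tmul_add, TensorProduct.tmul_smul,
        TensorProduct.smul_tmul']
      abel
    exact congrArg AlgHom.toLinearMap h

variable {p n lam}
variable {D : Type*} [CommRing D] [Algebra R D]

lemma conv_apply_T_pow (a b : WithConv (ALambda p n lam →ₗ[R] D)) (j : ℕ) :
    (a * b) (T p n lam ^ j) = ∑ i ∈ Finset.range (j + 1),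
      (j.choose i : D) * (a (T p n lam ^ i) * b (g p n lam ^ i * T p n lam ^ (j - i))) := by
  rw [LinearMap.convMul_apply, comul_T_pow, map_sum, map_sum]
  refine Finset.sum_congr rfl fun i _ => ?_
  rw [map_smul, map_smul, Algebra.smul_def, map_natCast]
  simp

lemma conv_apply_g_pow (a b : WithConv (ALambda p n lam →ₗ[R] D)) (k : ℕ) :
    (a * b) (g p n lam ^ k) = a (g p n lam ^ k) * b (g p n lam ^ k) := by
  rw [LinearMap.convMul_apply, comul_g_pow]
  simp

lemma conv_one_apply_g_pow (k : ℕ) :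
    (1 : WithConv (ALambda p n lam →ₗ[R] D)) (g p n lam ^ k) = 1 := by
  rw [LinearMap.convOne_apply, counit_g_pow, map_one]

lemma regRep_apply (i j : Fin (p ^ n)) : UnitScheme.regRep (basis p n lam) i j =
    ((j : ℕ).choose i : R) • (g p n lam ^ (i : ℕ) * T p n lam ^ (j - i : ℕ)) := by
  rw [UnitScheme.regRep, Matrix.of_apply, basis_apply, comul_T_pow, map_sum, map_sum]
  have h : ∀ k ∈ Finset.range ((j : ℕ) + 1), TensorProduct.lid R (ALambda p n lam)
      (((basis p n lam).coord i).rTensor (ALambda p n lam) (((j : ℕ).choose k : R) •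
        ((T p n lam ^ k) ⊗ₜ[R] (g p n lam ^ k * T p n lam ^ (j - k : ℕ))))) =
      if k = i then ((j : ℕ).choose i : R) • (g p n lam ^ (i : ℕ) * T p n lam ^ (j - i : ℕ))
        else 0 := by
    intro k hk
    have hk' : k < p ^ n := (Nat.lt_succ_iff.1 (Finset.mem_range.1 hk)).trans_lt j.2
    rw [map_smul, map_smul, LinearMap.rTensor_tmul, TensorProduct.lid_tmul,
      ← basis_mk lam hk', Module.Basis.coord_apply, Module.Basis.repr_self,
      Finsupp.single_apply]
    by_cases hki : k = i
    · subst hki; simp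
    · rw [if_neg (fun h => hki (by rw [← h])), if_neg hki]; simp
  rw [Finset.sum_congr rfl h, Finset.sum_ite_eq']
  split_ifs with hi
  · rfl
  · rw [Finset.mem_range, not_lt, Nat.succ_le_iff] at hi
    rw [Nat.choose_eq_zero_of_lt hi]; simp

/-- The matrix is triangular because `R_ij = binom(j,i) g^i T^(j-i)`. In particular the discriminant
of `S` factors into the values at the `g ^ i`. -/
lemma det_regRep (a : ALambda p n lam →ₗ[R] D) :
    ((UnitScheme.regRep (basis p n lam)).map a).det =
      ∏ i : Fin (p ^ n), a (g p n lam ^ (i : ℕ)) := by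
  rw [Matrix.det_of_isUpperTriangular]
  · simp [regRep_apply]
  · intro i j hij
    rw [Matrix.map_apply, regRep_apply, Nat.choose_eq_zero_of_lt (show (j : ℕ) < i from hij)]
    simp

lemma disc_basis : UnitScheme.disc (basis p n lam) =
    ∏ i : Fin (p ^ n), UnitScheme.gen (basis p n lam) (g p n lam ^ (i : ℕ)) :=
  det_regRep _

/-- A convolution element is invertible when its values at the powers of `1 + λ T` are. -/
lemma isUnit_conv (a : WithConv (ALambda p n lam →ₗ[R] D))
    (h : ∀ k, k < p ^ n → IsUnit (a (g p n lam ^ k))) : IsUnit a := by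
  set M := (UnitScheme.regRep (basis p n lam)).map a with hM
  have hdet : IsUnit M.det := by
    rw [hM, det_regRep]
    exact (IsUnit.prod_univ_iff).2 fun i => h i i.2
  let z : Fin (p ^ n) := ⟨0, pow_pos (Fact.out : p.Prime).pos n⟩
  -- Since `(y * a)(e_j) = ∑ y(e_i) a(R_ij)`, a left inverse is a row vector `y` with `y M` equal to
  -- the counit, the row indexed by `T ^ 0` of the identity matrix.
  let y : WithConv (ALambda p n lam →ₗ[R] D) :=
    toConv ((basis p n lam).constr R fun i => M⁻¹ z i)
  have hy : y * a = 1 := by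
    refine WithConv.ext ((basis p n lam).ext fun j => ?_)
    have h1 : (y * a) (basis p n lam j) = (M⁻¹ * M) z j := by
      rw [LinearMap.convMul_apply, UnitScheme.comul_basis, map_sum, map_sum, Matrix.mul_apply]
      refine Finset.sum_congr rfl fun i _ => ?_
      simp [y, hM]
    refine h1.trans ?_
    rw [Matrix.nonsing_inv_mul _ hdet]
    change _ = (1 : WithConv (ALambda p n lam →ₗ[R] D)) (basis p n lam j)
    rw [LinearMap.convOne_apply, basis_apply, Bialgebra.counit_pow, counit_T, Matrix.one_apply]
    by_cases hj : z = j
    · subst hj; simp [z]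
    · rw [if_neg hj, zero_pow, map_zero]
      intro h0
      exact hj (Fin.ext h0.symm)
  exact IsUnit.of_mul_eq_one _ (by rw [mul_comm]; exact hy)

lemma isUnit_powMap {u : D} (hu : IsUnit (1 + lam • u)) : IsUnit (powMap p n lam u) :=
  isUnit_conv _ fun k hk => by rw [powMap_g_pow u hk]; exact hu.pow k

lemma convMap_powMap {E : Type*} [CommRing E] [Algebra R E] (f : D →ₐ[R] E) (u : D) :
    convMap f (powMap p n lam u) = powMap p n lam (f u) :=
  conv_ext fun k hk => by
    rw [convMap_apply, powMap_T_pow _ hk, powMap_T_pow _ hk, map_pow]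

/-- The algebra map `S → D` given by an invertible convolution element. -/
def liftConv (a : WithConv (ALambda p n lam →ₗ[R] D))
    (h : ∀ k, k < p ^ n → IsUnit (a (g p n lam ^ k))) : SLambda p n lam →ₐ[R] D :=
  UnitScheme.liftS (basis p n lam) (MvPolynomial.aeval fun i => a (basis p n lam i)) (by
    rw [disc_basis, map_prod]
    refine (IsUnit.prod_univ_iff).2 fun i => ?_
    rw [UnitScheme.aeval_gen]
    exact h i i.2)

lemma liftConv_genS (a : WithConv (ALambda p n lam →ₗ[R] D))
    (h : ∀ k, k < p ^ n → IsUnit (a (g p n lam ^ k))) (x : ALambda p n lam) :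
    liftConv a h (UnitScheme.genS (basis p n lam) x) = a x := by
  rw [liftConv, UnitScheme.liftS_genS, UnitScheme.aeval_gen]

end ALambda

/-! ### The coinvariant convolution quotient and the elements `P_s`. -/

namespace ALambda

variable {R : Type*} [CommRing R] (p n : ℕ) [Fact p.Prime] (lam : R)

/-- Expand `q(g^s)` binomially: the `T`-term drops out and the constant term is `1 / z 0`. This
turns the denominators of `ZRing` into values at group-likes, both in `S` and in `Cover`. -/
lemma sum_normalized {p n : ℕ} {lam : R} {D : Type*} [CommRing D] [Algebra R D]
    (q : WithConv (ALambda p n lam →ₗ[R] D)) (z : ℕ → D) (h0 : z 0 * q 1 = 1)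
    (h1 : q (T p n lam) = 0) (s : ℕ) (hs : 2 ≤ s)
    (hz : ∀ k, 2 ≤ k → k ≤ s → z k = z 0 ^ (k + 1) * q (T p n lam ^ k)) :
    z 0 ^ s + ∑ k ∈ Finset.Ico 2 s, (s.choose k * lam ^ k : R) • (z 0 ^ (s - k) * z k)
      + lam ^ s • z s = z 0 ^ (s + 1) * q (g p n lam ^ s) := by
  rw [apply_g_pow, Finset.sum_range_succ, Finset.range_eq_Ico,
    Finset.sum_eq_sum_Ico_succ_bot (show 0 < s by omega),
    Finset.sum_eq_sum_Ico_succ_bot (show 0 + 1 < s by omega),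
    mul_add, mul_add, mul_add, Finset.mul_sum, ← add_assoc]
  congr 1
  · congr 1
    · simp only [Nat.choose_zero_right, Nat.cast_one, pow_zero, mul_one, one_smul, zero_add,
        pow_one, h1, smul_zero, mul_zero, add_zero]
      rw [pow_succ, mul_assoc, h0, mul_one]
    · rw [zero_add, one_add_one_eq_two]
      refine Finset.sum_congr rfl fun k hk => ?_
      rw [Finset.mem_Ico] at hk
      rw [hz k hk.1 hk.2.le, mul_smul_comm, ← mul_assoc, ← pow_add,
        show s - k + (k + 1) = s + 1 by omega]
  · rw [hz s hs le_rfl]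
    simp

variable {p n lam} in
lemma powMap_one {D : Type*} [CommRing D] [Algebra R D] (u : D) : powMap p n lam u 1 = 1 := by
  simpa using powMap_T_pow (lam := lam) u (pow_pos (Fact.out : p.Prime).pos n)

lemma one_lt_pow {p n : ℕ} [Fact p.Prime] (hn : 0 < n) : 1 < p ^ n :=
  Nat.one_lt_pow hn.ne' (Fact.out : p.Prime).one_lt

variable {p n} in
lemma powMap_T {D : Type*} [CommRing D] [Algebra R D] (hn : 0 < n) (u : D) :
    powMap p n lam u (T p n lam) = u := by
  simpa using powMap_T_pow (lam := lam) u (one_lt_pow hn)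

variable [Algebra (ZMod p) R]

/-- The tautological element of the convolution ring over `S`, `T ^ s ↦ X_{T^s}`. -/
def genConv : WithConv (ALambda p n lam →ₗ[R] SLambda p n lam) :=
  toConv (UnitScheme.genS (basis p n lam))

lemma genConv_T_pow (s : ℕ) : genConv p n lam (T p n lam ^ s) = XT p n lam s := rfl

lemma genConv_one : genConv p n lam 1 = XT p n lam 0 := by
  rw [← genConv_T_pow, pow_zero]

lemma genConv_T : genConv p n lam (T p n lam) = XT p n lam 1 := by
  rw [← genConv_T_pow, pow_one]

lemma genConv_g_pow (s : ℕ) : genConv p n lam (g p n lam ^ s) = ell p n lam s :=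
  apply_g_pow _ s

lemma genConv_g : genConv p n lam (g p n lam) = ell p n lam 1 := by
  rw [← genConv_g_pow, pow_one]

lemma ell_one : ell p n lam 1 = XT p n lam 0 + lam • XT p n lam 1 := by
  simp [ell, Finset.sum_range_succ]

variable {p n} in
lemma isUnit_ell {s : ℕ} (hs : s < p ^ n) : IsUnit (ell p n lam s) := by
  have h : IsUnit (algebraMap _ (SLambda p n lam) (UnitScheme.disc (basis p n lam))) :=
    IsLocalization.Away.algebraMap_isUnit _
  have hd := congrArg (algebraMap _ (SLambda p n lam)) (disc_basis (p := p) (n := n) (lam := lam))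
  rw [map_prod] at hd
  rw [hd, IsUnit.prod_univ_iff] at h
  rw [← genConv_g_pow]
  exact h ⟨s, hs⟩

lemma isUnit_XT_zero : IsUnit (XT p n lam 0) := by
  have := isUnit_ell lam (pow_pos (Fact.out : p.Prime).pos n)
  rwa [← genConv_g_pow, pow_zero, genConv_one] at this

lemma isUnit_genConv : IsUnit (genConv p n lam) :=
  isUnit_conv _ fun k hk => by
    rw [genConv_g_pow]
    exact isUnit_ell lam hk

/-- The quotient `X_T / X_1`. -/
def ratio : SLambda p n lam := XT p n lam 1 * Ring.inverse (XT p n lam 0)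

lemma XT_zero_mul_ratio : XT p n lam 0 * ratio p n lam = XT p n lam 1 := by
  rw [ratio, mul_left_comm, Ring.mul_inverse_cancel _ (isUnit_XT_zero p n lam), mul_one]

lemma XT_zero_mul_one_add_ratio :
    XT p n lam 0 * (1 + lam • ratio p n lam) = ell p n lam 1 := by
  rw [mul_add, mul_one, mul_smul_comm, XT_zero_mul_ratio, ell_one]

/-- The convolution quotient of `T ^ s ↦ (X_T / X_1) ^ s` by `T ^ s ↦ X_{T^s}`. -/
def quot : WithConv (ALambda p n lam →ₗ[R] SLambda p n lam) :=
  powMap p n lam (ratio p n lam) * Ring.inverse (genConv p n lam)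

lemma quot_mul_genConv :
    quot p n lam * genConv p n lam = powMap p n lam (ratio p n lam) := by
  rw [quot, mul_assoc, Ring.inverse_mul_cancel _ (isUnit_genConv p n lam), mul_one]

/-- The element `P_(λ)(X_T^s)` of `S`. -/
def PT (s : ℕ) : SLambda p n lam := XT p n lam 0 ^ (s + 1) * quot p n lam (T p n lam ^ s)

variable {p n lam} in
lemma conv_apply_one {D : Type*} [CommRing D] [Algebra R D]
    (a b : WithConv (ALambda p n lam →ₗ[R] D)) : (a * b) 1 = a 1 * b 1 := by
  simpa using conv_apply_g_pow a b 0

variable {p n lam} in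
lemma conv_apply_T {D : Type*} [CommRing D] [Algebra R D]
    (a b : WithConv (ALambda p n lam →ₗ[R] D)) :
    (a * b) (T p n lam) = a (T p n lam) * b (g p n lam) + a 1 * b (T p n lam) := by
  rw [LinearMap.convMul_apply, comul_T]
  simp

lemma XT_zero_mul_quot_one : XT p n lam 0 * quot p n lam 1 = 1 := by
  have h := conv_apply_one (quot p n lam) (genConv p n lam)
  rw [quot_mul_genConv, powMap_one, genConv_one] at h
  rw [h, mul_comm]

variable {n} in
-- Evaluated at `T`, the identity `quot * genConv = powMap r` reads `r = quot(T) · ell 1 + X_T /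
-- X_1`, and `r` is the last term. This is why the index `1` carries no `P`.
lemma quot_T (hn : 0 < n) : quot p n lam (T p n lam) = 0 := by
  have h := conv_apply_T (quot p n lam) (genConv p n lam)
  rw [quot_mul_genConv, powMap_T lam hn, genConv_g, genConv_T] at h
  have h2 : XT p n lam 0 * (quot p n lam (T p n lam) * ell p n lam 1) = 0 := by
    linear_combination (-XT p n lam 0) * h - XT p n lam 1 * XT_zero_mul_quot_one p n lam
      + XT_zero_mul_ratio p n lam
  rwa [(isUnit_XT_zero p n lam).mul_right_eq_zero,
    (isUnit_ell lam (one_lt_pow hn)).mul_left_eq_zero] at h2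

variable {p n} in
lemma quot_g_pow_mul_ell {s : ℕ} (hs : s < p ^ n) :
    XT p n lam 0 ^ (s + 1) * quot p n lam (g p n lam ^ s) * ell p n lam s =
      ell p n lam 1 ^ s * XT p n lam 0 := by
  have h := conv_apply_g_pow (quot p n lam) (genConv p n lam) s
  rw [quot_mul_genConv, powMap_g_pow _ hs, genConv_g_pow] at h
  rw [← XT_zero_mul_one_add_ratio, mul_assoc, ← h, mul_pow]
  ring

variable {p n} in
lemma isUnit_quot_g_pow {s : ℕ} (hn : 0 < n) (hs : s < p ^ n) :
    IsUnit (XT p n lam 0 ^ (s + 1) * quot p n lam (g p n lam ^ s)) := by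
  refine isUnit_of_mul_isUnit_left (y := ell p n lam s) ?_
  rw [quot_g_pow_mul_ell lam hs]
  exact ((isUnit_ell lam (one_lt_pow hn)).pow s).mul (isUnit_XT_zero p n lam)

variable {p n} in
-- By `sum_normalized` the bracket together with the leading term is `X_1^(s+1) quot(g^s)`, and
-- convolution is multiplicative at the group-like `g^s`.
lemma PT_recursion (hn : 0 < n) (s : ℕ) (h2 : 2 ≤ s) (hs : s < p ^ n) :
    lam ^ s • PT p n lam s * ell p n lam s =
      (XT p n lam 0 + lam • XT p n lam 1) ^ s * XT p n lam 0
        - (XT p n lam 0 ^ s + ∑ k ∈ Finset.Ico 2 s,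
            (s.choose k * lam ^ k : R) • (XT p n lam 0 ^ (s - k) * PT p n lam k))
          * ell p n lam s := by
  have h := sum_normalized (quot p n lam)
    (fun k => if k = 0 then XT p n lam 0 else PT p n lam k)
    (by simpa using XT_zero_mul_quot_one p n lam) (quot_T p lam hn) s h2
    (fun k hk _ => by simp [PT, show k ≠ 0 by omega])
  simp only [if_true, show s ≠ 0 by omega, if_false] at h
  have hsum : ∑ k ∈ Finset.Ico 2 s, (s.choose k * lam ^ k : R) •
      (XT p n lam 0 ^ (s - k) * if k = 0 then XT p n lam 0 else PT p n lam k) =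
      ∑ k ∈ Finset.Ico 2 s, (s.choose k * lam ^ k : R) •
        (XT p n lam 0 ^ (s - k) * PT p n lam k) := by
    refine Finset.sum_congr rfl fun k hk => ?_
    rw [Finset.mem_Ico] at hk
    rw [if_neg (by omega)]
  rw [hsum] at h
  rw [← ell_one, ← quot_g_pow_mul_ell lam hs, ← h]
  ring

variable {p n} in
/-- The triangular system with diagonal `ell s` that determines the elements `PT s`. -/
lemma sum_PT_mul_genConv {s : ℕ} (hs : s < p ^ n) :
    ∑ i ∈ Finset.range (s + 1), (s.choose i : SLambda p n lam) * (PT p n lam i *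
      XT p n lam 0 ^ (s - i) * genConv p n lam (g p n lam ^ i * T p n lam ^ (s - i))) =
    XT p n lam 1 ^ s * XT p n lam 0 := by
  have h := conv_apply_T_pow (quot p n lam) (genConv p n lam) s
  rw [quot_mul_genConv, powMap_T_pow _ hs] at h
  have h' : XT p n lam 1 ^ s * XT p n lam 0 = XT p n lam 0 ^ (s + 1) * ratio p n lam ^ s := by
    rw [← XT_zero_mul_ratio]; ring
  rw [h', h, Finset.mul_sum]
  refine Finset.sum_congr rfl fun i hi => ?_
  rw [Finset.mem_range] at hi
  have hX : XT p n lam 0 ^ (s + 1) = XT p n lam 0 ^ (i + 1) * XT p n lam 0 ^ (s - i) := by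
    rw [← pow_add, show i + 1 + (s - i) = s + 1 by omega]
  rw [PT, hX]
  ring

end ALambda

/-! ### Compatibility with the substitution `Λ ↦ λ`. -/

namespace ALambda

open Polynomial

variable {R : Type*} [CommRing R] (p n : ℕ) [Fact p.Prime] [Algebra (ZMod p) R] (lam : R)

/-- The substitution `Λ ↦ λ` on polynomials in the `X_{T^s}`. -/
def substPoly : MvPolynomial (Fin (p ^ n)) R[X] →+* SLambda p n lam :=
  MvPolynomial.eval₂Hom ((algebraMap R (SLambda p n lam)).comp (evalRingHom lam))
    fun i => XT p n lam i

lemma substPoly_smul (f : R[X]) (x : MvPolynomial (Fin (p ^ n)) R[X]) :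
    substPoly p n lam (f • x) = f.eval lam • substPoly p n lam x := by
  rw [MvPolynomial.smul_eq_C_mul, map_mul, Algebra.smul_def]
  simp [substPoly]

variable {p n} in
lemma substPoly_gen_T_pow {s : ℕ} (hs : s < p ^ n) :
    substPoly p n lam (UnitScheme.gen (basis p n (X : R[X])) (T p n (X : R[X]) ^ s)) =
      XT p n lam s := by
  rw [← basis_mk _ hs, UnitScheme.gen_basis]
  simp [substPoly]

lemma isUnit_substPoly_disc :
    IsUnit (substPoly p n lam (UnitScheme.disc (basis p n (X : R[X])))) := by
  rw [disc_basis (lam := (X : R[X])), map_prod, IsUnit.prod_univ_iff]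
  intro i
  have h : substPoly p n lam (UnitScheme.gen (basis p n (X : R[X])) (g p n (X : R[X]) ^ (i : ℕ))) =
      ell p n lam i := by
    rw [apply_g_pow, map_sum]
    refine Finset.sum_congr rfl fun k hk => ?_
    rw [substPoly_smul, substPoly_gen_T_pow lam
      ((Nat.lt_succ_iff.1 (Finset.mem_range.1 hk)).trans_lt i.2)]
    simp
  rw [h]
  exact isUnit_ell lam i.2

/-- The substitution `Λ ↦ λ`. -/
def subst : SLambda p n (X : R[X]) →+* SLambda p n lam :=
  IsLocalization.Away.lift (UnitScheme.disc (basis p n (X : R[X]))) (isUnit_substPoly_disc p n lam)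

lemma subst_algebraMap (x : MvPolynomial (Fin (p ^ n)) R[X]) :
    subst p n lam (algebraMap _ _ x) = substPoly p n lam x :=
  IsLocalization.Away.lift_eq _ _ _

variable {p n} in
lemma subst_XT {s : ℕ} (hs : s < p ^ n) :
    subst p n lam (XT p n (X : R[X]) s) = XT p n lam s :=
  (subst_algebraMap p n lam _).trans (substPoly_gen_T_pow lam hs)

lemma subst_algebraMap_base (f : R[X]) :
    subst p n lam (algebraMap R[X] _ f) = algebraMap R _ (f.eval lam) := by
  rw [IsScalarTower.algebraMap_apply R[X] (MvPolynomial (Fin (p ^ n)) R[X]), subst_algebraMap]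
  simp [substPoly, MvPolynomial.algebraMap_eq]

lemma isSubstitution_subst : IsSubstitution p n lam (subst p n lam) :=
  ⟨subst_algebraMap_base p n lam, fun _ hs => subst_XT lam hs⟩

variable {p n} in
lemma subst_genConv {i j : ℕ} (h : i + j < p ^ n) :
    subst p n lam (genConv p n (X : R[X]) (g p n (X : R[X]) ^ i * T p n (X : R[X]) ^ j)) =
      genConv p n lam (g p n lam ^ i * T p n lam ^ j) := by
  have h1 := apply_g_pow ((genConv p n (X : R[X])).ofConv ∘ₗ
    LinearMap.mulRight R[X] (T p n (X : R[X]) ^ j)) i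
  have h2 := apply_g_pow ((genConv p n lam).ofConv ∘ₗ LinearMap.mulRight R (T p n lam ^ j)) i
  simp only [LinearMap.comp_apply, LinearMap.mulRight_apply, ← pow_add, genConv_T_pow] at h1 h2
  rw [h1, h2, map_sum]
  refine Finset.sum_congr rfl fun k hk => ?_
  rw [Finset.mem_range] at hk
  rw [Algebra.smul_def, Algebra.smul_def, map_mul, subst_XT lam (by omega), subst_algebraMap_base]
  simp

variable {p n} in
-- The recursion cannot be used, since `λ` may be a zero divisor. The triangular system
-- `sum_PT_mul_genConv` has the unit `ell s` on the diagonal, so its solution specializes.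
lemma subst_PT {s : ℕ} (hs : s < p ^ n) :
    subst p n lam (PT p n (X : R[X]) s) = PT p n lam s := by
  induction s using Nat.strong_induction_on with
  | _ s ih =>
  have h1 := congrArg (subst p n lam) (sum_PT_mul_genConv (X : R[X]) hs)
  have h2 := sum_PT_mul_genConv lam hs
  have hp : 0 < p ^ n := by omega
  have h1' : subst p n lam (XT p n (X : R[X]) 1 ^ s * XT p n (X : R[X]) 0) =
      XT p n lam 1 ^ s * XT p n lam 0 := by
    rw [map_mul, map_pow, subst_XT lam hp]
    -- `X_T` is a generator only if `1 < p ^ n`, which is known once `0 < s < p ^ n`; for `s = 0` it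
    -- does not occur.
    rcases Nat.eq_zero_or_pos s with rfl | hs0
    · simp
    · rw [subst_XT lam (by omega)]
  rw [h1', ← h2, map_sum, Finset.sum_range_succ, Finset.sum_range_succ] at h1
  have hsum : ∑ i ∈ Finset.range s, subst p n lam ((s.choose i : SLambda p n (X : R[X])) *
      (PT p n (X : R[X]) i * XT p n (X : R[X]) 0 ^ (s - i) *
        genConv p n (X : R[X]) (g p n (X : R[X]) ^ i * T p n (X : R[X]) ^ (s - i)))) =
      ∑ i ∈ Finset.range s, (s.choose i : SLambda p n lam) * (PT p n lam i *
        XT p n lam 0 ^ (s - i) * genConv p n lam (g p n lam ^ i * T p n lam ^ (s - i))) := by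
    refine Finset.sum_congr rfl fun i hi => ?_
    rw [Finset.mem_range] at hi
    rw [map_mul, map_mul, map_mul, map_pow, map_natCast, ih i hi (by omega), subst_XT lam hp,
      subst_genConv lam (by omega)]
  rw [hsum, add_right_inj, map_mul, map_mul, subst_genConv lam (by omega)] at h1
  simp only [Nat.choose_self, Nat.cast_one, map_one, one_mul, Nat.sub_self, pow_zero, mul_one,
    genConv_g_pow] at h1
  exact (isUnit_ell lam hs).mul_right_cancel h1

lemma isGenericP_PT {n : ℕ} (hn : 0 < n) : IsGenericP R p n (PT p n (X : R[X])) :=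
  fun s h2 hs => PT_recursion (X : R[X]) hn s h2 hs

end ALambda

/-! ### Coinvariance of the generators and the map `ZRing → S`. -/

namespace ALambda

variable {R : Type*} [CommRing R] {p n : ℕ} {lam : R}

lemma map_zden {D : Type*} [CommRing D] [Algebra R D] (f : MvPolynomial (Fin (p ^ n)) R →ₐ[R] D)
    (s : ℕ) : f (zden p n lam s) = f (zvar R p n 0) ^ s + ∑ k ∈ Finset.Ico 2 s,
      (s.choose k * lam ^ k : R) • (f (zvar R p n 0) ^ (s - k) * f (zvar R p n k))
        + lam ^ s • f (zvar R p n s) := by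
  simp only [zden, map_add, map_sum, map_smul, map_mul, map_pow]

lemma aeval_zvar {D : Type*} [CommRing D] [Algebra R D] (v : ℕ → D) {k : ℕ} (hk : k < p ^ n) :
    MvPolynomial.aeval (fun i : Fin (p ^ n) => v i) (zvar R p n k) = v k := by
  rw [zvar, dif_pos hk, MvPolynomial.aeval_X]

lemma ZRing_algHom_ext {D : Type*} [CommRing D] [Algebra R D] {f f' : ZRing p n lam →ₐ[R] D}
    (h : ∀ k, k < p ^ n → f (ZT p n lam k) = f' (ZT p n lam k)) : f = f' := by
  apply IsLocalization.algHom_ext (Submonoid.powers (zvar R p n 0 *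
    (zvar R p n 0 ^ p ^ n + lam ^ p ^ n • zvar R p n 1) *
      ∏ s ∈ Finset.Ico 2 (p ^ n), zden p n lam s))
  apply MvPolynomial.algHom_ext
  intro i
  have hz : ZT p n lam i = algebraMap _ _ (MvPolynomial.X i) := congrArg _ (dif_pos i.2)
  have := h i i.2
  rw [hz] at this
  exact this

variable (p n lam) [Fact p.Prime] [Algebra (ZMod p) R]

/-- The coaction of `A` on `S`. -/
abbrev rho : SLambda p n lam →ₐ[R] SLambda p n lam ⊗[R] ALambda p n lam :=
  UnitScheme.coaction (basis p n lam)

/-- The inclusion `x ↦ x ⊗ 1`. -/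
abbrev incl : SLambda p n lam →ₐ[R] SLambda p n lam ⊗[R] ALambda p n lam :=
  Algebra.TensorProduct.includeLeft

/-- The inclusion `A → S ⊗ A` as a convolution element. -/
def inclRight : WithConv (ALambda p n lam →ₗ[R] SLambda p n lam ⊗[R] ALambda p n lam) :=
  toConv (Algebra.TensorProduct.includeRight (R := R) (A := SLambda p n lam)).toLinearMap

lemma inclRight_apply (x : ALambda p n lam) : inclRight p n lam x = 1 ⊗ₜ[R] x := rfl

/-- The coaction is right translation of the universal point by the points of `Spec A`, seen as
group-likes of the group algebra. -/
lemma rho_genConv :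
    convMap (rho p n lam) (genConv p n lam) =
      convMap (incl p n lam) (genConv p n lam) * inclRight p n lam := by
  refine WithConv.ext (LinearMap.ext fun h => ?_)
  change rho p n lam (UnitScheme.genS _ h) = LinearMap.mul' R _ (TensorProduct.map
    (convMap (incl p n lam) (genConv p n lam)).ofConv (inclRight p n lam).ofConv
      (Coalgebra.comul (R := R) h))
  rw [UnitScheme.coaction_genS]
  generalize Coalgebra.comul (R := R) h = z
  induction z with
  | zero => simp
  | add x y hx hy => simp only [map_add, hx, hy]
  | tmul x y =>
    rw [TensorProduct.map_tmul, LinearMap.mul'_apply, convMap_apply, inclRight_apply]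
    simp [genConv]

lemma rho_XT_zero : rho p n lam (XT p n lam 0) = XT p n lam 0 ⊗ₜ[R] 1 := by
  have h := congrArg (fun a => a.ofConv 1) (rho_genConv p n lam)
  simpa only [conv_apply_one, convMap_apply, inclRight_apply, genConv_one,
    Algebra.TensorProduct.includeLeft_apply, Algebra.TensorProduct.tmul_mul_tmul, mul_one] using h

lemma rho_XT_one : rho p n lam (XT p n lam 1) =
    XT p n lam 1 ⊗ₜ[R] g p n lam + XT p n lam 0 ⊗ₜ[R] T p n lam := by
  have h := congrArg (fun a => a.ofConv (T p n lam)) (rho_genConv p n lam)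
  simpa only [conv_apply_T, convMap_apply, inclRight_apply, genConv_one, genConv_T,
    Algebra.TensorProduct.includeLeft_apply, Algebra.TensorProduct.tmul_mul_tmul, mul_one,
    one_mul] using h

lemma rho_XT_one_pow :
    rho p n lam (XT p n lam 1 ^ p ^ n) = (XT p n lam 1 ^ p ^ n) ⊗ₜ[R] 1 := by
  rw [map_pow, rho_XT_one, add_pow_p (R := R), Algebra.TensorProduct.tmul_pow,
    Algebra.TensorProduct.tmul_pow, T_pow, g, one_add_pow, TensorProduct.tmul_zero, add_zero]

lemma rho_ratio : rho p n lam (ratio p n lam) =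
    ratio p n lam ⊗ₜ[R] g p n lam + 1 ⊗ₜ[R] T p n lam := by
  have hu : IsUnit (incl p n lam (XT p n lam 0)) := (isUnit_XT_zero p n lam).map _
  refine hu.mul_left_cancel ?_
  have h := congrArg (rho p n lam) (XT_zero_mul_ratio p n lam)
  rw [map_mul, rho_XT_zero, rho_XT_one] at h
  rw [Algebra.TensorProduct.includeLeft_apply, h, mul_add, Algebra.TensorProduct.tmul_mul_tmul,
    Algebra.TensorProduct.tmul_mul_tmul, XT_zero_mul_ratio, one_mul, one_mul, mul_one]

/-- Expanding `(r ⊗ g + 1 ⊗ T)^k` gives the same binomial sum as the convolution formula at `T^k`.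
-/
lemma rho_powMap_ratio :
    convMap (rho p n lam) (powMap p n lam (ratio p n lam)) =
      convMap (incl p n lam) (powMap p n lam (ratio p n lam)) * inclRight p n lam := by
  refine conv_ext fun k hk => ?_
  rw [conv_apply_T_pow, convMap_apply, powMap_T_pow _ hk, map_pow, rho_ratio, add_pow]
  refine Finset.sum_congr rfl fun i hi => ?_
  rw [convMap_apply, powMap_T_pow _ ((Nat.lt_succ_iff.1 (Finset.mem_range.1 hi)).trans_lt hk),
    inclRight_apply, Algebra.TensorProduct.includeLeft_apply]
  simp only [Algebra.TensorProduct.tmul_pow, Algebra.TensorProduct.tmul_mul_tmul, one_pow, mul_one,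
    one_mul]
  ring

/-- Numerator and denominator of `quot` acquire the same right factor, which cancels. -/
lemma rho_quot : convMap (rho p n lam) (quot p n lam) = convMap (incl p n lam) (quot p n lam) := by
  have hu : IsUnit (convMap (rho p n lam) (genConv p n lam)) := (isUnit_genConv p n lam).map _
  refine hu.mul_right_cancel ?_
  rw [← map_mul, quot_mul_genConv, rho_genConv, rho_powMap_ratio, ← mul_assoc, ← map_mul,
    quot_mul_genConv]

lemma rho_PT (s : ℕ) : rho p n lam (PT p n lam s) = PT p n lam s ⊗ₜ[R] 1 := by
  have h := congrArg (fun a => a.ofConv (T p n lam ^ s)) (rho_quot p n lam)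
  simp only [convMap_apply, Algebra.TensorProduct.includeLeft_apply] at h
  rw [PT, map_mul, map_pow, rho_XT_zero, h, Algebra.TensorProduct.tmul_pow,
    Algebra.TensorProduct.tmul_mul_tmul, one_pow, one_mul]

/-- The images of the variables `Z_{T^k}` in `S`. -/
def zval (k : ℕ) : SLambda p n lam :=
  if k = 0 then XT p n lam 0 else if k = 1 then XT p n lam 1 ^ p ^ n else PT p n lam k

lemma zval_zero : zval p n lam 0 = XT p n lam 0 := rfl

lemma zval_one : zval p n lam 1 = XT p n lam 1 ^ p ^ n := rfl

lemma zval_of_two_le {k : ℕ} (hk : 2 ≤ k) : zval p n lam k = PT p n lam k := by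
  rw [zval, if_neg (by omega), if_neg (by omega)]

lemma rho_zval (k : ℕ) : rho p n lam (zval p n lam k) = zval p n lam k ⊗ₜ[R] 1 := by
  rw [zval]
  split_ifs
  · exact rho_XT_zero p n lam
  · exact rho_XT_one_pow p n lam
  · exact rho_PT p n lam k

variable {p n lam}

/-- By Frobenius the second denominator becomes `(ell 1)^(p^n)`; the others become `X_1^(s+1)
quot(g^s)`, a unit because its product with `ell s` is one. -/
lemma isUnit_aeval_zval (hn : 0 < n) :
    IsUnit (MvPolynomial.aeval (fun i : Fin (p ^ n) => zval p n lam i) (zvar R p n 0 *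
      (zvar R p n 0 ^ p ^ n + lam ^ p ^ n • zvar R p n 1) *
        ∏ s ∈ Finset.Ico 2 (p ^ n), zden p n lam s)) := by
  have hN := one_lt_pow (p := p) hn
  rw [map_mul, map_mul, map_add, map_pow, map_smul, map_prod, aeval_zvar _ (by omega),
    aeval_zvar _ hN, zval_zero, zval_one, ← _root_.smul_pow, ← add_pow_p (R := R), ← ell_one]
  refine ((isUnit_XT_zero p n lam).mul ((isUnit_ell lam hN).pow _)).mul
    (IsUnit.prod_iff.2 fun s hs => ?_)
  obtain ⟨h2, hs⟩ := Finset.mem_Ico.1 hs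
  have h := sum_normalized (quot p n lam) (zval p n lam) (XT_zero_mul_quot_one p n lam)
    (quot_T p lam hn) s h2 (fun k hk _ => zval_of_two_le p n lam hk)
  have hsum : ∑ k ∈ Finset.Ico 2 s, (s.choose k * lam ^ k : R) • (zval p n lam 0 ^ (s - k) *
      MvPolynomial.aeval (fun i : Fin (p ^ n) => zval p n lam i) (zvar R p n k)) =
      ∑ k ∈ Finset.Ico 2 s,
        (s.choose k * lam ^ k : R) • (zval p n lam 0 ^ (s - k) * zval p n lam k) :=
    Finset.sum_congr rfl fun k hk => by
      rw [aeval_zvar _ ((Finset.mem_Ico.1 hk).2.trans hs)]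
  rw [map_zden, aeval_zvar _ (by omega), hsum, aeval_zvar _ hs, h]
  exact isUnit_quot_g_pow lam hn hs

variable (p lam) in
/-- The algebra map `ZRing → S` with `Z_{T^k} ↦ zval k`. -/
def zHom (hn : 0 < n) : ZRing p n lam →ₐ[R] SLambda p n lam :=
  IsLocalization.Away.liftAlgHom _ (f := MvPolynomial.aeval fun i : Fin (p ^ n) => zval p n lam i)
    (isUnit_aeval_zval hn)

lemma zHom_ZT (hn : 0 < n) {k : ℕ} (hk : k < p ^ n) :
    zHom p lam hn (ZT p n lam k) = zval p n lam k :=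
  (IsLocalization.Away.lift_eq _ (isUnit_aeval_zval hn) _).trans (aeval_zvar _ hk)

lemma zHom_mem_coinv (hn : 0 < n) (x : ZRing p n lam) : zHom p lam hn x ∈ coinvLambda p n lam := by
  have h : (rho p n lam).comp (zHom p lam hn) = (incl p n lam).comp (zHom p lam hn) :=
    ZRing_algHom_ext fun k hk => by
      rw [AlgHom.comp_apply, AlgHom.comp_apply, zHom_ZT hn hk, rho_zval]
      rfl
  exact DFunLike.congr_fun h x

end ALambda

/-! ### Identifying `S` with the extension of `ZRing` by a `p^n`-th root of `Z_T`. -/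

namespace ALambda

open Polynomial

section ZRing

variable {R : Type*} [CommRing R] (p n : ℕ) (lam : R)

lemma isUnit_ZRing_denominators : IsUnit (ZT p n lam 0) ∧
    IsUnit (ZT p n lam 0 ^ p ^ n + lam ^ p ^ n • ZT p n lam 1) ∧
    ∀ s, 2 ≤ s → s < p ^ n → IsUnit (algebraMap _ (ZRing p n lam) (zden p n lam s)) := by
  have h : IsUnit (algebraMap _ (ZRing p n lam) (zvar R p n 0 *
      (zvar R p n 0 ^ p ^ n + lam ^ p ^ n • zvar R p n 1) *
        ∏ s ∈ Finset.Ico 2 (p ^ n), zden p n lam s)) :=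
    IsLocalization.Away.algebraMap_isUnit _
  rw [map_mul, map_mul, map_add, map_pow, map_prod, IsUnit.mul_iff, IsUnit.mul_iff,
    IsUnit.prod_iff] at h
  have hs : algebraMap _ (ZRing p n lam) (lam ^ p ^ n • zvar R p n 1) =
      lam ^ p ^ n • ZT p n lam 1 :=
    map_smul (IsScalarTower.toAlgHom R _ (ZRing p n lam)) _ _
  rw [hs] at h
  exact ⟨h.1.1, h.1.2, fun s h2 hs => h.2 s (Finset.mem_Ico.2 ⟨h2, hs⟩)⟩

/-- The defining polynomial `x ^ (p ^ n) - Z_T` of `Cover`. -/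
def coverPoly : (ZRing p n lam)[X] := X ^ p ^ n - C (ZT p n lam 1)

/-- The extension of `ZRing` by a `p ^ n`-th root of `Z_T`. -/
abbrev Cover : Type _ := AdjoinRoot (coverPoly p n lam)

/-- The element `Z_{T^k}` of `Cover`. -/
def cz (k : ℕ) : Cover p n lam := AdjoinRoot.of (coverPoly p n lam) (ZT p n lam k)

/-- The adjoined root of `Z_T`. -/
def cx : Cover p n lam := AdjoinRoot.root (coverPoly p n lam)

lemma cx_pow : cx p n lam ^ p ^ n = cz p n lam 1 := by
  have h := AdjoinRoot.eval₂_root (coverPoly p n lam)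
  rw [coverPoly, eval₂_sub, eval₂_pow, eval₂_X, eval₂_C, sub_eq_zero] at h
  exact h

lemma isUnit_cz_zero : IsUnit (cz p n lam 0) :=
  (isUnit_ZRing_denominators p n lam).1.map _

/-- The quotient `x / Z_1`. -/
def cratio : Cover p n lam := cx p n lam * Ring.inverse (cz p n lam 0)

lemma cz_zero_mul_cratio : cz p n lam 0 * cratio p n lam = cx p n lam := by
  rw [cratio, mul_left_comm, Ring.mul_inverse_cancel _ (isUnit_cz_zero p n lam), mul_one]

variable [Fact p.Prime]

lemma monic_coverPoly : (coverPoly p n lam).Monic :=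
  monic_X_pow_sub_C _ (pow_ne_zero _ (Fact.out : p.Prime).ne_zero)

/-- Constants are their own remainders modulo a monic polynomial of positive degree. -/
lemma of_coverPoly_injective :
    Function.Injective (AdjoinRoot.of (coverPoly p n lam)) := by
  rcases subsingleton_or_nontrivial (ZRing p n lam) with h | h
  · exact fun _ _ _ => Subsingleton.elim _ _
  rw [injective_iff_map_eq_zero]
  intro a ha
  have h1 := AdjoinRoot.modByMonicHom_mk (monic_coverPoly p n lam) (C a)
  rw [AdjoinRoot.mk_C, ha, map_zero, (modByMonic_eq_self_iff (monic_coverPoly p n lam)).2] at h1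
  · exact C_eq_zero.1 h1.symm
  · rw [coverPoly, degree_X_pow_sub_C (pow_pos (Fact.out : p.Prime).pos n)]
    exact degree_C_le.trans_lt (by exact_mod_cast pow_pos (Fact.out : p.Prime).pos n)

/-- The convolution element `T ^ k ↦ Z_{T^k} / Z_1 ^ (k + 1)` over `Cover`, normalized to
`1 ↦ 1 / Z_1` and `T ↦ 0`. -/
def cquot : WithConv (ALambda p n lam →ₗ[R] Cover p n lam) :=
  toConv ((basis p n lam).constr R fun i => if (i : ℕ) = 0 then Ring.inverse (cz p n lam 0) else
    if (i : ℕ) = 1 then 0 else Ring.inverse (cz p n lam 0) ^ ((i : ℕ) + 1) * cz p n lam i)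

variable {p n} in
lemma cquot_T_pow {k : ℕ} (hk : k < p ^ n) : cquot p n lam (T p n lam ^ k) =
    if k = 0 then Ring.inverse (cz p n lam 0) else
      if k = 1 then 0 else Ring.inverse (cz p n lam 0) ^ (k + 1) * cz p n lam k := by
  rw [← basis_mk lam hk]
  exact (basis p n lam).constr_basis R _ _

lemma cz_zero_mul_cquot_one : cz p n lam 0 * cquot p n lam 1 = 1 := by
  rw [← pow_zero (T p n lam), cquot_T_pow lam (pow_pos (Fact.out : p.Prime).pos n), if_pos rfl,
    Ring.mul_inverse_cancel _ (isUnit_cz_zero p n lam)]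

variable {n} in
lemma cquot_T (hn : 0 < n) : cquot p n lam (T p n lam) = 0 := by
  rw [← pow_one (T p n lam), cquot_T_pow lam (one_lt_pow hn), if_neg one_ne_zero, if_pos rfl]

variable {p n} in
lemma cz_eq_mul_cquot {k : ℕ} (h2 : 2 ≤ k) (hk : k < p ^ n) :
    cz p n lam k = cz p n lam 0 ^ (k + 1) * cquot p n lam (T p n lam ^ k) := by
  rw [cquot_T_pow lam hk, if_neg (by omega), if_neg (by omega), ← mul_assoc, ← mul_pow,
    Ring.mul_inverse_cancel _ (isUnit_cz_zero p n lam), one_pow, one_mul]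

variable {p n} in
lemma isUnit_cquot_g_pow (hn : 0 < n) {s : ℕ} (hs : s < p ^ n) :
    IsUnit (cquot p n lam (g p n lam ^ s)) := by
  have h1 : IsUnit (cquot p n lam 1) :=
    isUnit_of_mul_isUnit_right (x := cz p n lam 0) (by simp [cz_zero_mul_cquot_one])
  rcases Nat.lt_or_ge s 2 with h | h2
  -- Below `2` there is no denominator to use, but `q(g) = q(1) + λ q(T) = q(1)`.
  · have hg : cquot p n lam (g p n lam ^ s) = cquot p n lam 1 := by
      interval_cases s
      · rw [pow_zero]
      · rw [pow_one, g, map_add, map_smul, cquot_T p lam hn, smul_zero, add_zero]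
    rwa [hg]
  · have h := sum_normalized (cquot p n lam) (cz p n lam) (cz_zero_mul_cquot_one p n lam)
      (cquot_T p lam hn) s h2 (fun k hk hks => cz_eq_mul_cquot lam hk (hks.trans_lt hs))
    have hz : AdjoinRoot.ofAlgHom R (coverPoly p n lam) (IsScalarTower.toAlgHom R _ _
        (zden p n lam s)) = cz p n lam 0 ^ (s + 1) * cquot p n lam (g p n lam ^ s) :=
      (map_zden ((AdjoinRoot.ofAlgHom R (coverPoly p n lam)).comp
        (IsScalarTower.toAlgHom R _ (ZRing p n lam))) s).trans h
    refine isUnit_of_mul_isUnit_right (x := cz p n lam 0 ^ (s + 1)) ?_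
    rw [← hz]
    exact ((isUnit_ZRing_denominators p n lam).2.2 s h2 hs).map _

variable [Algebra (ZMod p) R]

variable {p n lam} in
lemma isUnit_apply_g_pow {D : Type*} [CommRing D] [Algebra R D]
    {a : WithConv (ALambda p n lam →ₗ[R] D)} (ha : IsUnit a) (k : ℕ) :
    IsUnit (a (g p n lam ^ k)) := by
  obtain ⟨b, hb⟩ := ha.exists_right_inv
  refine IsUnit.of_mul_eq_one (b (g p n lam ^ k)) ?_
  rw [← conv_apply_g_pow, hb, conv_one_apply_g_pow]

/-- By Frobenius, `(Z_1 (1 + λ x / Z_1))^(p^n)` is the inverted element `Z_1^(p^n) + λ^(p^n) Z_T`.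
-/
lemma isUnit_one_add_cratio : IsUnit (1 + lam • cratio p n lam) := by
  have hp : p ^ n ≠ 0 := pow_ne_zero _ (Fact.out : p.Prime).ne_zero
  refine isUnit_of_mul_isUnit_right (x := cz p n lam 0) ((isUnit_pow_iff hp).1 ?_)
  have h1 : (cz p n lam 0 * (1 + lam • cratio p n lam)) ^ p ^ n =
      cz p n lam 0 ^ p ^ n + lam ^ p ^ n • cz p n lam 1 := by
    rw [← cx_pow, ← _root_.smul_pow, ← add_pow_p (R := R) p n (cz p n lam 0),
      ← cz_zero_mul_cratio]
    congr 1
    rw [mul_add (cz p n lam 0), mul_one, mul_smul_comm]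
  have h := (isUnit_ZRing_denominators p n lam).2.1.map
    (AdjoinRoot.ofAlgHom R (coverPoly p n lam))
  rw [map_add, map_pow, map_smul] at h
  exact h1 ▸ h

lemma isUnit_cquot (hn : 0 < n) : IsUnit (cquot p n lam) :=
  isUnit_conv _ fun _ hk => isUnit_cquot_g_pow lam hn hk

/-- The invertible convolution element over `Cover` that corresponds to `S → Cover`. -/
def cgen : WithConv (ALambda p n lam →ₗ[R] Cover p n lam) :=
  Ring.inverse (cquot p n lam) * powMap p n lam (cratio p n lam)

variable {n} in
lemma cquot_mul_cgen (hn : 0 < n) :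
    cquot p n lam * cgen p n lam = powMap p n lam (cratio p n lam) := by
  rw [cgen, ← mul_assoc, Ring.mul_inverse_cancel _ (isUnit_cquot p n lam hn), one_mul]

variable {n} in
lemma isUnit_cgen (hn : 0 < n) : IsUnit (cgen p n lam) := by
  refine isUnit_of_mul_isUnit_right (x := cquot p n lam) ?_
  rw [cquot_mul_cgen p lam hn]
  exact isUnit_powMap (isUnit_one_add_cratio p n lam)

variable {n} in
lemma cgen_one (hn : 0 < n) : cgen p n lam 1 = cz p n lam 0 := by
  have h := conv_apply_one (cquot p n lam) (cgen p n lam)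
  rw [cquot_mul_cgen p lam hn, powMap_one] at h
  linear_combination (-cz p n lam 0) * h - cgen p n lam 1 * cz_zero_mul_cquot_one p n lam

variable {n} in
lemma cgen_T (hn : 0 < n) : cgen p n lam (T p n lam) = cx p n lam := by
  have h := conv_apply_T (cquot p n lam) (cgen p n lam)
  rw [cquot_mul_cgen p lam hn, powMap_T lam hn, cquot_T p lam hn, zero_mul, zero_add] at h
  rw [← cz_zero_mul_cratio, h, ← mul_assoc, cz_zero_mul_cquot_one, one_mul]

variable {n}

/-- The algebra map `S → Cover`. -/
def toCover (hn : 0 < n) : SLambda p n lam →ₐ[R] Cover p n lam :=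
  liftConv (cgen p n lam) fun k _ => isUnit_apply_g_pow (isUnit_cgen p lam hn) k

lemma toCover_genConv (hn : 0 < n) :
    convMap (toCover p lam hn) (genConv p n lam) = cgen p n lam :=
  WithConv.ext (LinearMap.ext fun x => liftConv_genS _
    (fun k _ => isUnit_apply_g_pow (isUnit_cgen p lam hn) k) x)

lemma toCover_XT_zero (hn : 0 < n) : toCover p lam hn (XT p n lam 0) = cz p n lam 0 := by
  rw [← genConv_one, ← convMap_apply, toCover_genConv, cgen_one p lam hn]

lemma toCover_XT_one (hn : 0 < n) : toCover p lam hn (XT p n lam 1) = cx p n lam := by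
  rw [← genConv_T, ← convMap_apply, toCover_genConv, cgen_T p lam hn]

lemma toCover_ratio (hn : 0 < n) : toCover p lam hn (ratio p n lam) = cratio p n lam := by
  refine (isUnit_cz_zero p n lam).mul_left_cancel ?_
  rw [cz_zero_mul_cratio, ← toCover_XT_zero p lam hn, ← map_mul, XT_zero_mul_ratio,
    toCover_XT_one]

/-- Both sides solve `q * cgen = powMap cratio`, and `cgen` is invertible. -/
lemma toCover_quot (hn : 0 < n) : convMap (toCover p lam hn) (quot p n lam) = cquot p n lam := by
  refine (isUnit_cgen p lam hn).mul_right_cancel ?_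
  rw [cquot_mul_cgen p lam hn, ← toCover_genConv p lam hn, ← map_mul, quot_mul_genConv,
    convMap_powMap, toCover_ratio]

lemma toCover_zval (hn : 0 < n) {k : ℕ} (hk : k < p ^ n) :
    toCover p lam hn (zval p n lam k) = cz p n lam k := by
  rcases Nat.lt_or_ge k 2 with h | h2
  · interval_cases k
    · exact toCover_XT_zero p lam hn
    · rw [zval_one, map_pow, toCover_XT_one, cx_pow]
  · rw [zval_of_two_le _ _ _ h2, PT, map_mul, map_pow, toCover_XT_zero, ← convMap_apply,
      toCover_quot, cz_eq_mul_cquot lam h2 hk]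

lemma toCover_zHom (hn : 0 < n) (b : ZRing p n lam) :
    toCover p lam hn (zHom p lam hn b) = AdjoinRoot.of (coverPoly p n lam) b := by
  have h : (toCover p lam hn).comp (zHom p lam hn) = AdjoinRoot.ofAlgHom R (coverPoly p n lam) :=
    ZRing_algHom_ext fun k hk => by
      rw [AlgHom.comp_apply, zHom_ZT hn hk, toCover_zval p lam hn hk]
      rfl
  exact DFunLike.congr_fun h b

/-- Composed with `toCover`, it is the injective structure map of `Cover`. -/
lemma zHom_injective (hn : 0 < n) : Function.Injective (zHom p lam hn) := fun a b h =>
  of_coverPoly_injective p n lam (by rw [← toCover_zHom p lam hn, h, toCover_zHom])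

/-- The algebra map `Cover → S` that extends `zHom` by `x ↦ X_T`. -/
def ofCover (hn : 0 < n) : Cover p n lam →ₐ[R] SLambda p n lam :=
  AdjoinRoot.liftAlgHom _ (zHom p lam hn) (XT p n lam 1) (by
    rw [coverPoly, eval₂_sub, eval₂_pow, eval₂_X, eval₂_C, sub_eq_zero]
    exact ((zHom_ZT hn (one_lt_pow hn)).trans (zval_one p n lam)).symm)

lemma ofCover_cz (hn : 0 < n) {k : ℕ} (hk : k < p ^ n) :
    ofCover p lam hn (cz p n lam k) = zval p n lam k :=
  (AdjoinRoot.liftAlgHom_of _ _ _ _ _).trans (zHom_ZT hn hk)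

lemma ofCover_cx (hn : 0 < n) : ofCover p lam hn (cx p n lam) = XT p n lam 1 :=
  AdjoinRoot.liftAlgHom_root _ _ _ _

lemma ofCover_cz_zero (hn : 0 < n) : ofCover p lam hn (cz p n lam 0) = XT p n lam 0 :=
  ofCover_cz p lam hn (pow_pos (Fact.out : p.Prime).pos n)

lemma ofCover_cratio (hn : 0 < n) : ofCover p lam hn (cratio p n lam) = ratio p n lam := by
  refine (isUnit_XT_zero p n lam).mul_left_cancel ?_
  rw [XT_zero_mul_ratio, ← ofCover_cz_zero p lam hn, ← map_mul, cz_zero_mul_cratio, ofCover_cx]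

lemma ofCover_cquot (hn : 0 < n) : convMap (ofCover p lam hn) (cquot p n lam) = quot p n lam := by
  refine conv_ext fun k hk => ?_
  refine ((isUnit_XT_zero p n lam).pow (k + 1)).mul_left_cancel ?_
  rw [convMap_apply]
  rcases Nat.lt_or_ge k 2 with h | h2
  · interval_cases k
    · rw [pow_zero, zero_add, pow_one, XT_zero_mul_quot_one, ← ofCover_cz_zero p lam hn, ← map_mul,
        cz_zero_mul_cquot_one, map_one]
    · rw [pow_one, cquot_T p lam hn, quot_T p lam hn, map_zero]
  · rw [← PT, ← zval_of_two_le p n lam h2, ← ofCover_cz p lam hn hk, cz_eq_mul_cquot lam h2 hk,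
      map_mul, map_pow (ofCover p lam hn), ofCover_cz_zero]

/-- The universal point is recovered from `quot` and `ratio`, which `ofCover` hits; hence `ofCover`
is a left inverse of `toCover`. -/
lemma ofCover_cgen (hn : 0 < n) : convMap (ofCover p lam hn) (cgen p n lam) = genConv p n lam := by
  have hu : IsUnit (quot p n lam) := by
    rw [← ofCover_cquot p lam hn]
    exact (isUnit_cquot p n lam hn).map _
  refine hu.mul_left_cancel ?_
  rw [quot_mul_genConv, ← ofCover_cquot p lam hn, ← map_mul, cquot_mul_cgen p lam hn,
    convMap_powMap, ofCover_cratio]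

lemma ofCover_toCover (hn : 0 < n) (x : SLambda p n lam) :
    ofCover p lam hn (toCover p lam hn x) = x := by
  have h : (ofCover p lam hn).comp (toCover p lam hn) = AlgHom.id R _ := by
    refine UnitScheme.algHom_ext _ fun i => ?_
    have h1 := congrArg (fun a => a.ofConv (basis p n lam i)) (ofCover_cgen p lam hn)
    rw [← toCover_genConv p lam hn] at h1
    exact h1
  exact DFunLike.congr_fun h x

end ZRing

/-! ### Coinvariants by comparison of coefficients in `S ⊗ A`. -/

section Descent

variable {R : Type*} [CommRing R] (p : ℕ) {n : ℕ} [Fact p.Prime] [Algebra (ZMod p) R] (lam : R)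

/-- Every element of `S` is a combination of `1, X_T, …, X_T ^ (p ^ n - 1)` with coefficients in
the image of `zHom`. -/
lemma exists_eq_sum_zHom (hn : 0 < n) (x : SLambda p n lam) : ∃ b : ℕ → ZRing p n lam,
    x = ∑ i ∈ Finset.range (p ^ n), zHom p lam hn (b i) * XT p n lam 1 ^ i := by
  rcases subsingleton_or_nontrivial (ZRing p n lam) with h | h
  · have := (zHom p lam hn).codomain_trivial
    exact ⟨0, Subsingleton.elim _ _⟩
  have hm := monic_coverPoly p n lam
  set q := AdjoinRoot.modByMonicHom hm (toCover p lam hn x)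
  have hq : AdjoinRoot.mk (coverPoly p n lam) q = toCover p lam hn x :=
    AdjoinRoot.mk_leftInverse hm _
  have hd : q.natDegree < p ^ n := by
    obtain ⟨r, hr⟩ := AdjoinRoot.mk_surjective (toCover p lam hn x)
    have hN : (coverPoly p n lam).natDegree = p ^ n := natDegree_X_pow_sub_C
    have : q = r %ₘ coverPoly p n lam := by
      rw [← AdjoinRoot.modByMonicHom_mk hm, hr]
    rw [this]
    refine (natDegree_modByMonic_lt r hm fun h1 => ?_).trans_eq hN
    rw [h1, natDegree_one] at hN
    have := one_lt_pow (p := p) hn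
    omega
  refine ⟨q.coeff, ?_⟩
  conv_lhs => rw [← ofCover_toCover p lam hn x, ← hq]
  rw [ofCover, AdjoinRoot.liftAlgHom_mk, eval₂_eq_sum_range' _ hd]
  rfl

/-- The coefficient of `T ^ m` of an element of `S ⊗ A`. -/
def coeffT (m : Fin (p ^ n)) : SLambda p n lam ⊗[R] ALambda p n lam →ₗ[R] SLambda p n lam :=
  (TensorProduct.rid R _).toLinearMap ∘ₗ ((basis p n lam).coord m).lTensor _

lemma coeffT_tmul_T_pow (m : Fin (p ^ n)) (y : SLambda p n lam) {k : ℕ} (hk : k < p ^ n) :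
    coeffT p lam m (y ⊗ₜ[R] (T p n lam ^ k)) = if k = m then y else 0 := by
  rw [← basis_mk lam hk]
  simp [coeffT, Finsupp.single_apply, Fin.ext_iff]

lemma rho_XT_one_eq : rho p n lam (XT p n lam 1) =
    ell p n lam 1 ⊗ₜ[R] T p n lam + XT p n lam 1 ⊗ₜ[R] 1 := by
  rw [rho_XT_one, ell_one, g, TensorProduct.tmul_add, TensorProduct.add_tmul,
    TensorProduct.tmul_smul, TensorProduct.smul_tmul']
  abel

/-- Expand `(ell 1 ⊗ T + X_T ⊗ 1)^i`; as `i < p ^ n`, no power of `T` is truncated. -/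
lemma coeffT_rho (m : Fin (p ^ n)) {a : SLambda p n lam} (ha : a ∈ coinvLambda p n lam) {i : ℕ}
    (hi : i < p ^ n) :
    coeffT p lam m (rho p n lam (a * XT p n lam 1 ^ i)) =
      i.choose m * (a * (ell p n lam 1 ^ (m : ℕ) * XT p n lam 1 ^ (i - m))) := by
  have ha' : rho p n lam a = a ⊗ₜ[R] 1 := ha
  rw [map_mul, map_pow, ha', rho_XT_one_eq, add_pow, Finset.mul_sum, map_sum]
  have h : ∀ k ∈ Finset.range (i + 1), coeffT p lam m (a ⊗ₜ[R] (1 : ALambda p n lam) *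
      ((ell p n lam 1 ⊗ₜ[R] T p n lam) ^ k * (XT p n lam 1 ⊗ₜ[R] 1) ^ (i - k) *
        (i.choose k : SLambda p n lam ⊗[R] ALambda p n lam))) =
      if k = m then i.choose m * (a * (ell p n lam 1 ^ (m : ℕ) * XT p n lam 1 ^ (i - m))) else 0 := by
    intro k hk
    have hk' : k < p ^ n := (Nat.lt_succ_iff.1 (Finset.mem_range.1 hk)).trans_lt hi
    have h1 : a ⊗ₜ[R] (1 : ALambda p n lam) *
        ((ell p n lam 1 ⊗ₜ[R] T p n lam) ^ k * (XT p n lam 1 ⊗ₜ[R] 1) ^ (i - k) *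
          (i.choose k : SLambda p n lam ⊗[R] ALambda p n lam)) =
        (i.choose k * (a * (ell p n lam 1 ^ k * XT p n lam 1 ^ (i - k)))) ⊗ₜ[R]
          (T p n lam ^ k) := by
      have hc : (i.choose k : SLambda p n lam ⊗[R] ALambda p n lam) =
          (i.choose k : SLambda p n lam) ⊗ₜ[R] 1 := by
        rw [← Algebra.TensorProduct.includeLeft_apply (S := R), map_natCast]
      rw [hc]
      simp only [Algebra.TensorProduct.tmul_pow, Algebra.TensorProduct.tmul_mul_tmul, one_pow,
        mul_one, one_mul]
      congr 1
      ring
    rw [h1, coeffT_tmul_T_pow p lam m _ hk']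
    split_ifs with hkm
    · rw [hkm]
    · rfl
  rw [Finset.sum_congr rfl h, Finset.sum_ite_eq']
  split_ifs with hm
  · rfl
  · rw [Finset.mem_range, not_lt, Nat.succ_le_iff] at hm
    rw [Nat.choose_eq_zero_of_lt hm, Nat.cast_zero, zero_mul]

/-- The coinvariants lie in the image of `zHom`. -/
lemma exists_zHom_eq (hn : 0 < n) {x : SLambda p n lam} (hx : x ∈ coinvLambda p n lam) :
    ∃ b, zHom p lam hn b = x := by
  obtain ⟨b, hb⟩ := exists_eq_sum_zHom p lam hn x
  have hN := one_lt_pow (p := p) hn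
  set a : ℕ → SLambda p n lam := fun i => zHom p lam hn (b i) with ha
  have key : ∀ m, 1 ≤ m → m < p ^ n → ∑ i ∈ Finset.range (p ^ n), (i.choose m : SLambda p n lam) *
      (a i * (ell p n lam 1 ^ m * XT p n lam 1 ^ (i - m))) = 0 := by
    intro m h1 hm
    have h : coeffT p lam ⟨m, hm⟩ (rho p n lam x) = 0 := by
      have hx' : rho p n lam x = x ⊗ₜ[R] (T p n lam ^ 0) := by
        rw [pow_zero]
        exact hx
      rw [hx', coeffT_tmul_T_pow p lam _ _ (by omega), if_neg]
      change ¬ 0 = m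
      omega
    rw [hb, map_sum, map_sum] at h
    rw [← h]
    refine Finset.sum_congr rfl fun i hi => ?_
    rw [coeffT_rho p lam _ (zHom_mem_coinv hn _) (Finset.mem_range.1 hi)]
  -- Descending induction on `m`, run as induction on `d ≥ p ^ n - m`: in `key m` the terms `i < m`
  -- have zero binomial coefficient and those with `i > m` vanish already, leaving `a m` times the
  -- unit `(ell 1)^m`.
  have hzero : ∀ d m, 1 ≤ m → m < p ^ n → p ^ n ≤ m + d → a m = 0 := by
    intro d
    induction d with
    | zero => intros; omega
    | succ d ih =>
      intro m h1 hm hd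
      have h := key m h1 hm
      rw [Finset.sum_eq_single_of_mem m (Finset.mem_range.2 hm)] at h
      · rw [Nat.choose_self, Nat.cast_one, one_mul, Nat.sub_self, pow_zero, mul_one,
          ((isUnit_ell lam hN).pow m).mul_left_eq_zero] at h
        exact h
      · intro i hi him
        rw [Finset.mem_range] at hi
        rcases Nat.lt_or_ge i m with hlt | hge
        · rw [Nat.choose_eq_zero_of_lt hlt, Nat.cast_zero, zero_mul]
        · rw [ih i (by omega) hi (by omega), zero_mul, mul_zero]
  refine ⟨b 0, ?_⟩
  rw [hb, Finset.sum_eq_single_of_mem 0 (Finset.mem_range.2 (by omega)), pow_zero, mul_one]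
  intro i hi hi0
  rw [show zHom p lam hn (b i) = 0 from
    hzero (p ^ n) i (by omega) (Finset.mem_range.1 hi) (by omega), zero_mul]

/-- The isomorphism of `ZRing` with the coinvariants of `S`. -/
def zEquiv (hn : 0 < n) : ZRing p n lam ≃ₐ[R] coinvLambda p n lam :=
  AlgEquiv.ofBijective ((zHom p lam hn).codRestrict _ (zHom_mem_coinv hn))
    ⟨fun _ _ h => zHom_injective p lam hn (congrArg Subtype.val h),
      fun x => (exists_zHom_eq p lam hn x.2).imp fun _ h => Subtype.ext h⟩

lemma coe_zEquiv (hn : 0 < n) (b : ZRing p n lam) :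
    (zEquiv p lam hn b : SLambda p n lam) = zHom p lam hn b := rfl

end Descent

end ALambda

end

theorem theorem3p7 (p n : ℕ) [Fact p.Prime] (hn : 0 < n) {R : Type*} [CommRing R]
    [Algebra (ZMod p) R] (lam : R) :
    ∃ (σ : SLambda p n (Polynomial.X : Polynomial R) →+* SLambda p n lam)
      (P : ℕ → SLambda p n (Polynomial.X : Polynomial R))
      (e : ZRing p n lam ≃ₐ[R] coinvLambda p n lam),
      IsSubstitution p n lam σ ∧
      IsGenericP R p n P ∧
      (e (ZT p n lam 0) : SLambda p n lam) = XT p n lam 0 ∧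
      (e (ZT p n lam 1) : SLambda p n lam) = XT p n lam 1 ^ p ^ n ∧
      ∀ s, 2 ≤ s → s < p ^ n → (e (ZT p n lam s) : SLambda p n lam) = σ (P s) := by
  have hN := ALambda.one_lt_pow (p := p) hn
  refine ⟨ALambda.subst p n lam, ALambda.PT p n Polynomial.X, ALambda.zEquiv p lam hn,
    ALambda.isSubstitution_subst p n lam, ALambda.isGenericP_PT p hn, ?_, ?_, fun s h2 hs => ?_⟩
  · exact ALambda.zHom_ZT hn (by omega)
  · exact ALambda.zHom_ZT hn hN
  · rw [ALambda.coe_zEquiv, ALambda.zHom_ZT hn hs, ALambda.zval_of_two_le _ _ _ h2,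
      ALambda.subst_PT lam hs]
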